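/- Let $X_1,X_2,\dots$ be i.i.d. random vectors with distribution function $F$ supported on $[0,\infty)^d$, and let $F_n(\boldsymbol t)=n^{-1}\sum_{i=1}^n\mathbb 1\{X_i\le \boldsymbol t\}$ (coordinatewise inequality) be the empirical distribution function. For $m>0$ the Szász–Mirakyan estimator with equal smoothing levels $m_1=\dots=m_d=m$ is $$F_{m,n}(\boldsymbol x)=\sum_{\boldsymbol k\in\mathbb N_0^d}F_n\Big(\frac{\boldsymbol k}{m}\Big)\prod_{j=1}^d e^{-mx_j}\frac{(mx_j)^{k_j}}{k_j!},$$ and $\mathrm{MSE}(F_{m,n}(\boldsymbol x))=\mathbb E[(F_{m,n}(\boldsymbol x)-F(\boldsymbol x))^2]$. Assume that $F$ is twice continuously differentiable on $(0,\infty)^d$ and that for every compact $S\subset(0,\infty)^d$ there are $\delta_S>0$ and $M_S<\infty$ such that all first and second partial derivatives of $F$ are bounded in absolute value by $M_S$ on $\{\boldsymbol y\in(0,\infty)^d:\exists \boldsymbol z\in S,\ \|\boldsymbol y-\boldsymbol z\|_1\le\delta_S\}$. Put $$\sigma^2(\boldsymbol x)=F(\boldsymbol x)\{1-F(\boldsymbol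 x)\},\qquad V(\boldsymbol x)=\sum_{j=1}^d\partial_{x_j}F(\boldsymbol x)\sqrt{x_j/\pi},\qquad B(\boldsymbol x)=\frac12\sum_{j=1}^d x_j\,\partial^2_{x_jx_j}F(\boldsymbol x).$$ (a) For every compact $S\subset(0,\infty)^d$, uniformly for $\boldsymbol x\in S$, as $n\to\infty$ and $m\to\infty$ (jointly, with no relation between $n$ and $m$, $m$ ranging over the positive reals and hence in particular over the positive integers), $$\mathrm{MSE}(F_{m,n}(\boldsymbol x))=n^{-1}\sigma^2(\boldsymbol x)-n^{-1}m^{-1/2}V(\boldsymbol x)+m^{-2}B^2(\boldsymbol x)+o(n^{-1}m^{-1/2})+o(m^{-2}).$$ (b) Let $\boldsymbol x\in(0,\infty)^d$ with $V(\boldsymbol x)B(\boldsymbol x)\ne0$, and put $$m_{\mathrm{opt}}(n)=n^{2/3}\Big[\frac{4B^2(\boldsymbol x)}{V(\boldsymbol x)}\Big]^{2/3}.$$ Then $m_{\mathrm{opt}}$ is the asymptotically optimal choice of $m$ for the MSE at $\boldsymbol x$, in the following sense: - for every $n\ge1$, $m_{\mathrm{opt}}(n)>0$ is the unique minimizer over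 $m>0$ of the leading part $n^{-1}\sigma^2(\boldsymbol x)-n^{-1}m^{-1/2}V(\boldsymbol x)+m^{-2}B^2(\boldsymbol x)$; - for a real sequence $(m_n)$, the following are equivalent: (i) $m_n\to\infty$ and, for every sequence $m_n'\to\infty$ and every $\varepsilon>0$, $\mathrm{MSE}(F_{m_n,n}(\boldsymbol x))\le\mathrm{MSE}(F_{m_n',n}(\boldsymbol x))+\varepsilon n^{-4/3}$ for all sufficiently large $n$; (ii) $m_n/m_{\mathrm{opt}}(n)\to1$. Moreover, for every sequence with $m_n/m_{\mathrm{opt}}(n)\to1$ (for instance $m_n=m_{\mathrm{opt}}(n)$ itself, or its rounding to an integer), as $n\to\infty$, $$\mathrm{MSE}(F_{m_n,n}(\boldsymbol x))=n^{-1}\sigma^2(\boldsymbol x)-\frac34\,n^{-4/3}\Big[\frac{V^4(\boldsymbol x)}{4B^2(\boldsymbol x)}\Big]^{1/3}+o(n^{-4/3}).$$ -/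

import Mathlib

open MeasureTheory ProbabilityTheory Filter Topology Asymptotics

noncomputable section

namespace Szasz

variable {d : ℕ}

/-- The open positive orthant `(0,∞)^d`. -/
def posOrthant (d : ℕ) : Set (Fin d → ℝ) := {x | ∀ j, 0 < x j}

/-- The `d`-variate distribution function `F(x) = μ((-∞,x₁] × ⋯ × (-∞,x_d])` of a law `μ`. -/
def distFun (μ : Measure (Fin d → ℝ)) (x : Fin d → ℝ) : ℝ := μ.real (Set.Iic x)

/-- The partial derivative `∂F/∂x_j`. -/
def partialDeriv (j : Fin d) (F : (Fin d → ℝ) → ℝ) (x : Fin d → ℝ) : ℝ :=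
  lineDeriv ℝ F x (Pi.single j 1)

/-- The second partial derivative `∂²F/∂x_i∂x_j`. -/
def partialDeriv₂ (i j : Fin d) (F : (Fin d → ℝ) → ℝ) (x : Fin d → ℝ) : ℝ :=
  partialDeriv i (partialDeriv j F) x

/-- The part of the `ℓ¹`-neighbourhood of radius `δ` of `S` inside the open orthant. -/
def l1Nhd (δ : ℝ) (S : Set (Fin d → ℝ)) : Set (Fin d → ℝ) :=
  {y | y ∈ posOrthant d ∧ ∃ z ∈ S, ∑ j, |y j - z j| ≤ δ}

/-- `F` is twice continuously differentiable on `(0,∞)^d`, with first and second partial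
derivatives bounded on a neighbourhood of each compact subset. -/
structure InteriorC2 (F : (Fin d → ℝ) → ℝ) : Prop where
  contDiffOn : ContDiffOn ℝ 2 F (posOrthant d)
  bounds : ∀ S : Set (Fin d → ℝ), IsCompact S → S ⊆ posOrthant d →
    ∃ δ > 0, ∃ M : ℝ, ∀ y ∈ l1Nhd δ S,
      (∀ i, |partialDeriv i F y| ≤ M) ∧ (∀ i j, |partialDeriv₂ i j F y| ≤ M)

open Classical in
/-- The empirical distribution function of the first `n` points of `X`; the order on `Fin d → ℝ`
is the coordinatewise one. -/
def empiricalCdf (X : ℕ → Fin d → ℝ) (n : ℕ) (t : Fin d → ℝ) : ℝ :=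
  (n : ℝ)⁻¹ * ∑ i ∈ Finset.range n, if X i ≤ t then 1 else 0

/-- The product Poisson weight `∏_j e^{-m_j x_j} (m_j x_j)^{k_j} / k_j!`. -/
def poissonWeight (m x : Fin d → ℝ) (k : Fin d → ℕ) : ℝ :=
  ∏ j, Real.exp (-(m j * x j)) * (m j * x j) ^ k j / (k j).factorial

/-- The Szász–Mirakyan estimator `∑_k F_n(k/m) P_{k,m}(x)`, for a vector `m` of positive
smoothing parameters. -/
def estimator (X : ℕ → Fin d → ℝ) (n : ℕ) (m x : Fin d → ℝ) : ℝ :=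
  ∑' k : Fin d → ℕ, empiricalCdf X n (fun j => (k j : ℝ) / m j) * poissonWeight m x k

/-- Mean squared error at `x` of the estimator with equal smoothing levels `m₁ = ⋯ = m_d = m`,
based on `X₀, …, X_{n-1}`, as an estimator of `F(x)`. -/
def mse {Ω : Type*} [MeasurableSpace Ω] (P : Measure Ω) (X : ℕ → Ω → Fin d → ℝ)
    (F : (Fin d → ℝ) → ℝ) (x : Fin d → ℝ) (n : ℕ) (m : ℝ) : ℝ :=
  ∫ ω, (estimator (fun i => X i ω) n (fun _ => m) x - F x) ^ 2 ∂P

/-- `σ²(x) = F(x)(1 - F(x))`. -/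
def sigmaSq (F : (Fin d → ℝ) → ℝ) (x : Fin d → ℝ) : ℝ := F x * (1 - F x)

/-- `V(x) = ∑_j ∂_j F(x) √(x_j/π)`. -/
def V (F : (Fin d → ℝ) → ℝ) (x : Fin d → ℝ) : ℝ :=
  ∑ j, partialDeriv j F x * Real.sqrt (x j / Real.pi)

/-- `B(x) = ½ ∑_j x_j ∂²_{jj} F(x)`. -/
def B (F : (Fin d → ℝ) → ℝ) (x : Fin d → ℝ) : ℝ :=
  (1 / 2) * ∑ j, x j * partialDeriv₂ j j F x

/-- The leading part `σ²/n - V/(n√m) + B²/m²` of the mean squared error. -/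
def leadingMse (F : (Fin d → ℝ) → ℝ) (x : Fin d → ℝ) (n : ℕ) (m : ℝ) : ℝ :=
  (n : ℝ)⁻¹ * sigmaSq F x - (n : ℝ)⁻¹ * m ^ (-(1 / 2) : ℝ) * V F x + m ^ (-2 : ℝ) * B F x ^ 2

/-- `m_opt(x) = n^{2/3} [4 B²(x) / V(x)]^{2/3}`. -/
def mOpt (F : (Fin d → ℝ) → ℝ) (x : Fin d → ℝ) (n : ℕ) : ℝ :=
  (n : ℝ) ^ (2 / 3 : ℝ) * (4 * B F x ^ 2 / V F x) ^ (2 / 3 : ℝ)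

/-- The smoothing sequence `m` tends to infinity and its risk is, up to `o(ρ n)`, at most the risk
of any other smoothing sequence that tends to infinity. -/
def IsAsymptoticallyOptimal (risk : ℕ → ℝ → ℝ) (ρ : ℕ → ℝ) (m : ℕ → ℝ) : Prop :=
  Tendsto m atTop atTop ∧ ∀ m' : ℕ → ℝ, Tendsto m' atTop atTop →
    ∀ ε > 0, ∀ᶠ n in atTop, risk n (m n) ≤ risk n (m' n) + ε * ρ n

end Szasz

end

/-! Let `K` be a vector of independent Poisson variables with means `m x_j`, and `K'` an independent
copy. The estimator is the Poisson expectation of `F_n(K/m)`, hence an average of the i.i.d.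
variables `g(X_i)`, where `g(y)` is the probability that `y ≤ K/m` (`estimator_eq`). So the MSE is
exactly `n⁻¹ (E g² - (E g)²)` plus the squared bias. By Fubini `E g = E F(K/m)` and `E g² = E F(K/m
⊓ K'/m)` (`mse_eq`).

For the bias, a second-order Taylor expansion at `x` and the Poisson moments (mean zero, variance
`x_j/m`, fourth moment `O(m⁻²)`) give `E F(K/m) = F + B/m + o(1/m)`. For the second moment, first
order suffices: since `min(a,b) = (a + b - |a - b|)/2`, the linear term has mean `-∑ ∂_j F · E|K_j -
K'_j| / (2m)`. With `E|N - N'| ~ 2√(r/π)` for independent Poisson variables of mean `r`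
(`tendsto_poissonAbsDiff_div_sqrt`), this is `-V/√m` up to `o(m^{-1/2})`. That asymptotic comes from
writing `|z|` as a multiple of `∫ (1 - cos(zt))/t² dt` and taking the limit of characteristic
functions under the integral. Compactness makes all estimates uniform (`eventually_mse`).

For part (b), monotonicity of `F` gives `V ≥ 0`, so `V > 0`. In the variable `t = (m/m_opt)^{-1/2}`
the leading part is `n⁻¹σ² + n^{-4/3} c (t⁴/4 - t)` with `c = [V⁴/(4B²)]^{1/3}` (`leadingMse_eq`).
Its excess over the minimum, at `t = 1`, is at least `n^{-4/3} c (t - 1)²/2`, and the error terms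
are at most small multiples of `n^{-4/3} (1 + excess)`. Hence near-optimality forces `t → 1`, and
conversely. -/

namespace Szasz

/-! ### Central moments of the Poisson law up to order four. -/

section Poisson

open scoped NNReal

/-- Stein's identity for the Poisson law: integrability. -/
lemma integrable_natCast_mul_poisson {r : ℝ≥0} {g : ℕ → ℝ}
    (hg : Integrable (fun n => g (n + 1)) (poissonMeasure r)) :
    Integrable (fun n : ℕ => (n : ℝ) * g n) (poissonMeasure r) := by
  rw [integrable_poissonMeasure_iff] at hg ⊢
  rw [← summable_nat_add_iff 1]
  refine (hg.mul_left (r : ℝ)).congr fun n => ?_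
  rw [norm_mul, Nat.factorial_succ, pow_succ]
  simp only [Nat.cast_mul, Nat.cast_add, Nat.cast_one, Real.norm_eq_abs]
  rw [abs_of_nonneg (by positivity : (0 : ℝ) ≤ (n : ℝ) + 1)]
  field_simp

/-- Stein's identity for the Poisson law. -/
lemma integral_natCast_mul_poisson {r : ℝ≥0} {g : ℕ → ℝ}
    (hg : Integrable (fun n => g (n + 1)) (poissonMeasure r)) :
    ∫ n : ℕ, (n : ℝ) * g n ∂poissonMeasure r = r * ∫ n, g (n + 1) ∂poissonMeasure r := by
  have h1 := hasSum_integral_poissonMeasure (integrable_natCast_mul_poisson hg)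
  have h2 := (hasSum_integral_poissonMeasure hg).mul_left (r : ℝ)
  rw [← hasSum_nat_add_iff' 1] at h1
  simp only [Finset.range_one, Finset.sum_singleton, Nat.cast_zero, zero_mul, smul_zero,
    sub_zero] at h1
  refine h1.unique (h2.congr_fun fun n => ?_)
  rw [Nat.factorial_succ, pow_succ]
  simp only [Nat.cast_mul, Nat.cast_add, Nat.cast_one, smul_eq_mul]
  field_simp

/-- Stein's identity trades a factor `n` for a shift of the argument, so the induction on the power
runs over all shifts `a` at once. -/
lemma integrable_add_pow_poisson (r : ℝ≥0) (p : ℕ) (a : ℝ) :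
    Integrable (fun n : ℕ => ((n : ℝ) + a) ^ p) (poissonMeasure r) := by
  induction p generalizing a with
  | zero => simp
  | succ p ih =>
    have h1 : Integrable (fun n : ℕ => (n : ℝ) * ((n : ℝ) + a) ^ p) (poissonMeasure r) := by
      apply integrable_natCast_mul_poisson (g := fun n => ((n : ℝ) + a) ^ p)
      refine (ih (1 + a)).congr (Eventually.of_forall fun n => ?_)
      push_cast
      ring
    refine (h1.add ((ih a).const_mul a)).congr (Eventually.of_forall fun n => ?_)
    simp only [Pi.add_apply]
    ring

lemma integral_poisson_sub (r : ℝ≥0) : ∫ n : ℕ, ((n : ℝ) - r) ∂poissonMeasure r = 0 := by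
  have h := integral_natCast_mul_poisson (r := r) (g := fun _ => 1) (by simp)
  have hi := integrable_add_pow_poisson r 1 0
  simp only [mul_one, integral_const, probReal_univ, smul_eq_mul] at h
  rw [integral_sub (by simpa using hi) (by simp)]
  simp [h]

lemma integrable_sub_pow_poisson (r : ℝ≥0) (p : ℕ) (a : ℝ) :
    Integrable (fun n : ℕ => ((n : ℝ) - a) ^ p) (poissonMeasure r) := by
  simpa [sub_eq_add_neg] using integrable_add_pow_poisson r p (-a)

/-- Recursion for the central moments of the Poisson law. -/
lemma integral_poisson_sub_pow_succ (r : ℝ≥0) (p : ℕ) :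
    ∫ n : ℕ, ((n : ℝ) - r) ^ (p + 1) ∂poissonMeasure r
      = r * (∫ n : ℕ, ((n : ℝ) - r + 1) ^ p ∂poissonMeasure r)
        - r * ∫ n : ℕ, ((n : ℝ) - r) ^ p ∂poissonMeasure r := by
  have e : ∀ n : ℕ, (((n + 1 : ℕ) : ℝ) - r) ^ p = ((n : ℝ) + (1 - r)) ^ p := by
    intro n; push_cast; ring
  have hi : Integrable (fun n : ℕ => (((n + 1 : ℕ) : ℝ) - r) ^ p) (poissonMeasure r) := by
    simp_rw [e]; exact integrable_add_pow_poisson r p _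
  have h := integral_natCast_mul_poisson (r := r) (g := fun n => ((n : ℝ) - r) ^ p) hi
  have h' := integrable_natCast_mul_poisson (r := r) (g := fun n => ((n : ℝ) - r) ^ p) hi
  have e2 : ∀ n : ℕ, ((n : ℝ) - r) ^ (p + 1)
      = (n : ℝ) * ((n : ℝ) - r) ^ p - r * ((n : ℝ) - r) ^ p := by intro n; ring
  simp_rw [e2]
  rw [integral_sub h' ((integrable_sub_pow_poisson r p r).const_mul _), h, integral_const_mul]
  congr 3
  ext n; push_cast; ring

lemma integral_poisson_sub_sq (r : ℝ≥0) : ∫ n : ℕ, ((n : ℝ) - r) ^ 2 ∂poissonMeasure r = r := by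
  have i1 : Integrable (fun n : ℕ => (n : ℝ) - r) (poissonMeasure r) := by
    simpa using integrable_sub_pow_poisson r 1 r
  rw [integral_poisson_sub_pow_succ]
  simp only [pow_one]
  rw [integral_add i1 (by simp), integral_poisson_sub]
  simp

lemma integral_poisson_sub_cube (r : ℝ≥0) : ∫ n : ℕ, ((n : ℝ) - r) ^ 3 ∂poissonMeasure r = r := by
  have i1 : Integrable (fun n : ℕ => (n : ℝ) - r) (poissonMeasure r) := by
    simpa using integrable_sub_pow_poisson r 1 r
  have i2 := integrable_sub_pow_poisson r 2 r
  have i0 : Integrable (fun _ : ℕ => (1 : ℝ)) (poissonMeasure r) := by simp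
  rw [integral_poisson_sub_pow_succ]
  have e : ∀ n : ℕ, ((n : ℝ) - r + 1) ^ 2 = ((n : ℝ) - r) ^ 2 + (2 * ((n : ℝ) - r) + 1) := by
    intro n; ring
  simp_rw [e]
  have j1 : Integrable (fun n : ℕ => 2 * ((n : ℝ) - r) + 1) (poissonMeasure r) :=
    (i1.const_mul 2).add i0
  rw [integral_add i2 j1,
    integral_add (i1.const_mul 2) (by simp), integral_const_mul, integral_poisson_sub]
  simp
  ring

lemma integral_poisson_sub_pow_four (r : ℝ≥0) :
    ∫ n : ℕ, ((n : ℝ) - r) ^ 4 ∂poissonMeasure r = r + 3 * r ^ 2 := by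
  have i1 : Integrable (fun n : ℕ => (n : ℝ) - r) (poissonMeasure r) := by
    simpa using integrable_sub_pow_poisson r 1 r
  have i2 := integrable_sub_pow_poisson r 2 r
  have i0 : Integrable (fun _ : ℕ => (1 : ℝ)) (poissonMeasure r) := by simp
  have i3 := integrable_sub_pow_poisson r 3 r
  rw [integral_poisson_sub_pow_succ]
  have e : ∀ n : ℕ, ((n : ℝ) - r + 1) ^ 3
      = ((n : ℝ) - r) ^ 3 + (3 * ((n : ℝ) - r) ^ 2 + (3 * ((n : ℝ) - r) + 1)) := by
    intro n; ring
  simp_rw [e]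
  have j1 : Integrable (fun n : ℕ => 3 * ((n : ℝ) - r) + 1) (poissonMeasure r) :=
    (i1.const_mul 3).add i0
  have j2 : Integrable (fun n : ℕ => 3 * ((n : ℝ) - r) ^ 2 + (3 * ((n : ℝ) - r) + 1))
      (poissonMeasure r) := (i2.const_mul 3).add j1
  rw [integral_add i3 j2, integral_add (i2.const_mul 3) j1,
    integral_add (i1.const_mul 3) (by simp), integral_const_mul, integral_const_mul,
    integral_poisson_sub, integral_poisson_sub_sq, integral_poisson_sub_cube]
  simp
  ring

end Poisson

/-! ### First absolute moments from characteristic functions, and the mean absolute Poisson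
difference. -/

section AbsoluteMoment

open scoped NNReal

lemma integrable_two_div_one_add_sq : Integrable fun t : ℝ => 4 * (1 + t ^ 2)⁻¹ :=
  integrable_inv_one_add_sq.const_mul 4

/-- `a / t² ≤ 4 / (1 + t²)` as soon as `a ≤ min(2, t²)`. -/
lemma div_sq_le_of_le {a t : ℝ} (h1 : a ≤ 2) (h2 : a ≤ t ^ 2) :
    a / t ^ 2 ≤ 4 * (1 + t ^ 2)⁻¹ := by
  rcases eq_or_ne t 0 with rfl | ht
  · simp
  · have : 0 < t ^ 2 := by positivity
    rw [← div_eq_mul_inv, div_le_div_iff₀ this (by positivity)]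
    nlinarith

lemma one_sub_cos_le_sq (t : ℝ) : 1 - Real.cos t ≤ t ^ 2 := by
  nlinarith [Real.one_sub_sq_div_two_le_cos (x := t), sq_nonneg t]

lemma one_sub_cos_div_sq_nonneg (z t : ℝ) : 0 ≤ (1 - Real.cos (z * t)) / t ^ 2 :=
  div_nonneg (sub_nonneg.2 (Real.cos_le_one _)) (sq_nonneg t)

lemma integrable_one_sub_cos_div_sq : Integrable fun t : ℝ => (1 - Real.cos t) / t ^ 2 := by
  refine integrable_two_div_one_add_sq.mono' ?_ (Eventually.of_forall fun t => ?_)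
  · exact (by fun_prop : Measurable fun t : ℝ => (1 - Real.cos t) / t ^ 2).aestronglyMeasurable
  · have h0 := one_sub_cos_div_sq_nonneg 1 t
    rw [one_mul] at h0
    rw [Real.norm_of_nonneg h0]
    exact div_sq_le_of_le (by linarith [Real.neg_one_le_cos t]) (one_sub_cos_le_sq t)

/-- Prepares the substitution `s = z t`: the factor `z²` against the Jacobian `|z|⁻¹` leaves `|z|`.
At `t = 0` both sides are `0`, as `a / 0 = 0`. -/
lemma one_sub_cos_mul_div_sq (z t : ℝ) :
    (1 - Real.cos (z * t)) / t ^ 2 = z ^ 2 * ((1 - Real.cos (z * t)) / (z * t) ^ 2) := by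
  rcases eq_or_ne z 0 with rfl | hz
  · simp
  · rcases eq_or_ne t 0 with rfl | ht
    · simp
    · field_simp

lemma integrable_one_sub_cos_mul_div_sq (z : ℝ) :
    Integrable fun t : ℝ => (1 - Real.cos (z * t)) / t ^ 2 := by
  rcases eq_or_ne z 0 with rfl | hz
  · simp
  · simp_rw [one_sub_cos_mul_div_sq z]
    exact (integrable_one_sub_cos_div_sq.comp_mul_left' hz).const_mul _

/-- The constant `∫ (1 - cos t) / t² dt`. -/
noncomputable def cosConst : ℝ := ∫ t : ℝ, (1 - Real.cos t) / t ^ 2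

/-- Positivity is all that is needed: the constant occurs both for the Poisson difference and for
its Gaussian limit, and cancels. -/
lemma cosConst_pos : 0 < cosConst := by
  have h0 : ∀ t : ℝ, 0 ≤ (1 - Real.cos t) / t ^ 2 := fun t => by
    simpa using one_sub_cos_div_sq_nonneg 1 t
  rw [cosConst, integral_pos_iff_support_of_nonneg h0 integrable_one_sub_cos_div_sq]
  have hsub : Set.Ioo 0 Real.pi ⊆ Function.support fun t : ℝ => (1 - Real.cos t) / t ^ 2 := by
    intro t ht
    have h1 : Real.cos t < 1 := by
      rw [← Real.cos_zero]
      exact Real.strictAntiOn_cos ⟨le_rfl, Real.pi_pos.le⟩ ⟨ht.1.le, ht.2.le⟩ ht.1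
    have h2 : t ≠ 0 := ht.1.ne'
    simp only [Function.mem_support, ne_eq, div_eq_zero_iff, not_or]
    exact ⟨by linarith, by positivity⟩
  refine lt_of_lt_of_le ?_ (measure_mono hsub)
  simp [Real.pi_pos]

lemma integral_one_sub_cos_mul_div_sq (z : ℝ) :
    ∫ t : ℝ, (1 - Real.cos (z * t)) / t ^ 2 = cosConst * |z| := by
  rcases eq_or_ne z 0 with rfl | hz
  · simp
  · simp_rw [one_sub_cos_mul_div_sq z]
    rw [integral_const_mul,
      Measure.integral_comp_mul_left (fun s : ℝ => (1 - Real.cos s) / s ^ 2) z, cosConst,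
      smul_eq_mul, abs_inv, ← sq_abs z]
    have : |z| ≠ 0 := abs_ne_zero.2 hz
    field_simp

/-- The first absolute moment in terms of the real part of the characteristic function. -/
lemma cosConst_mul_integral_abs {Ω : Type*} [MeasurableSpace Ω] {ν : Measure Ω}
    [IsProbabilityMeasure ν] {Z : Ω → ℝ} (hm : Measurable Z) (hZ : Integrable Z ν) :
    cosConst * ∫ ω, |Z ω| ∂ν = ∫ t : ℝ, (1 - ∫ ω, Real.cos (Z ω * t) ∂ν) / t ^ 2 := by
  have hmeas : Measurable (Function.uncurry fun (ω : Ω) (t : ℝ) =>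
      (1 - Real.cos (Z ω * t)) / t ^ 2) := by
    have h1 : Measurable fun p : Ω × ℝ => Z p.1 * p.2 :=
      (hm.comp measurable_fst).mul measurable_snd
    exact (measurable_const.sub (Real.measurable_cos.comp h1)).div (measurable_snd.pow_const 2)
  have hint : Integrable (Function.uncurry fun (ω : Ω) (t : ℝ) =>
      (1 - Real.cos (Z ω * t)) / t ^ 2) (ν.prod volume) := by
    -- The integrand is nonnegative with `t`-integral `cosConst * |Z|`, so integrability on the
    -- product comes from that of `Z`.
    rw [integrable_prod_iff hmeas.aestronglyMeasurable]
    refine ⟨Eventually.of_forall fun ω => ?_, ?_⟩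
    · exact integrable_one_sub_cos_mul_div_sq (Z ω)
    refine (hZ.abs.const_mul cosConst).congr (Eventually.of_forall fun ω => ?_)
    have e : ∀ t : ℝ, ‖Function.uncurry (fun (ω : Ω) (t : ℝ) =>
        (1 - Real.cos (Z ω * t)) / t ^ 2) (ω, t)‖ = (1 - Real.cos (Z ω * t)) / t ^ 2 :=
      fun t => Real.norm_of_nonneg (one_sub_cos_div_sq_nonneg (Z ω) t)
    simp only [e]
    exact (integral_one_sub_cos_mul_div_sq (Z ω)).symm
  rw [← integral_const_mul]
  simp_rw [← integral_one_sub_cos_mul_div_sq]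
  rw [integral_integral_swap hint]
  refine integral_congr_ae (Eventually.of_forall fun t => ?_)
  have hc : Integrable (fun ω => Real.cos (Z ω * t)) ν := by
    refine Integrable.of_bound (C := 1) ?_ (Eventually.of_forall fun ω => Real.abs_cos_le_one _)
    exact (Real.measurable_cos.comp (hm.mul_const t)).aestronglyMeasurable
  simp only
  rw [integral_div, integral_sub (by simp) hc]
  simp

/-- Variance `2` is that of `(N - N')/√r` for independent Poisson variables of mean `r`. -/
lemma integral_abs_gaussianReal_two : ∫ x : ℝ, |x| ∂gaussianReal 0 2 = 2 / √Real.pi := by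
  rw [integral_gaussianReal_eq_integral_smul (by norm_num)]
  have h1 : ∀ x : ℝ, gaussianPDFReal 0 2 x • |x|
      = (√(2 * Real.pi * (2 : ℝ≥0)))⁻¹ * (fun y : ℝ => y * Real.exp (-(1 / 4) * y ^ 2)) |x| := by
    intro x
    simp only [gaussianPDFReal, smul_eq_mul, sq_abs, sub_zero, NNReal.coe_ofNat]
    rw [show -x ^ 2 / (2 * 2) = -(1 / 4) * x ^ 2 by ring]
    ring
  simp_rw [h1]
  rw [integral_const_mul, integral_comp_abs (f := fun y : ℝ => y * Real.exp (-(1 / 4) * y ^ 2))]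
  have h2 := integral_rpow_mul_exp_neg_mul_rpow (p := 2) (q := 1) (b := 1 / 4) (by norm_num)
    (by norm_num) (by norm_num)
  have h3 : ∫ x in Set.Ioi (0 : ℝ), x * Real.exp (-(1 / 4) * x ^ 2) = 2 := by
    calc _ = ∫ x in Set.Ioi (0 : ℝ), x ^ (1 : ℝ) * Real.exp (-(1 / 4) * x ^ (2 : ℝ)) := by
          simp
      _ = _ := by
        rw [h2]
        norm_num [Real.rpow_neg_one]
  rw [h3, show (2 * Real.pi * ((2 : ℝ≥0) : ℝ)) = 2 ^ 2 * Real.pi by push_cast; ring,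
    Real.sqrt_mul (by norm_num), Real.sqrt_sq (by norm_num)]
  have : 0 < √Real.pi := Real.sqrt_pos.2 Real.pi_pos
  field_simp

lemma integral_cos_gaussianReal_two (t : ℝ) :
    ∫ x : ℝ, Real.cos (x * t) ∂gaussianReal 0 2 = Real.exp (-t ^ 2) := by
  have h := charFun_gaussianReal (μ := 0) (v := 2) t
  rw [charFun_apply_real] at h
  have hi : Integrable (fun x : ℝ => Complex.exp (t * x * Complex.I)) (gaussianReal 0 2) := by
    refine Integrable.of_bound (C := 1) (by fun_prop) (Eventually.of_forall fun x => ?_)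
    rw [← Complex.ofReal_mul, Complex.norm_exp_ofReal_mul_I]
  have h' := congrArg Complex.re h
  rw [← RCLike.re_eq_complex_re, ← integral_re hi] at h'
  have e : ∀ x : ℝ, RCLike.re (Complex.exp (t * x * Complex.I)) = Real.cos (x * t) := by
    intro x
    rw [RCLike.re_eq_complex_re, ← Complex.ofReal_mul, Complex.exp_ofReal_mul_I_re, mul_comm]
  simp_rw [e] at h'
  rw [h']
  have : ((t : ℂ) * ((0 : ℝ) : ℂ) * Complex.I - ((2 : ℝ≥0) : ℂ) * (t : ℂ) ^ 2 / 2)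
      = ((-t ^ 2 : ℝ) : ℂ) := by
    push_cast; ring
  rw [this, RCLike.re_eq_complex_re, Complex.exp_ofReal_re]

/-- Evaluates the limiting integral by reading `cosConst_mul_integral_abs` backwards for the
Gaussian law. -/
lemma integral_one_sub_exp_neg_sq_div_sq :
    ∫ t : ℝ, (1 - Real.exp (-t ^ 2)) / t ^ 2 = cosConst * (2 / √Real.pi) := by
  have h := cosConst_mul_integral_abs (ν := gaussianReal 0 2) (Z := fun x => x) measurable_id
    ((memLp_id_gaussianReal (μ := 0) (v := 2) 1).integrable le_rfl)
  rw [integral_abs_gaussianReal_two] at h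
  simp_rw [integral_cos_gaussianReal_two] at h
  exact h.symm

/-- The mean absolute difference of two independent Poisson variables. -/
noncomputable def poissonAbsDiff (r : ℝ≥0) : ℝ :=
  ∫ p : ℕ × ℕ, |(p.1 : ℝ) - p.2| ∂(poissonMeasure r).prod (poissonMeasure r)

/-- The characteristic function of a difference of two independent copies is the squared modulus
`|exp(r(e^{it} - 1))|²`, which is real. -/
lemma integral_cos_poisson_diff (r : ℝ≥0) (t : ℝ) :
    ∫ p : ℕ × ℕ, Real.cos (((p.1 : ℝ) - p.2) * t) ∂(poissonMeasure r).prod (poissonMeasure r)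
      = Real.exp (-(2 * r * (1 - Real.cos t))) := by
  have h := charFun_map_cast_poissonMeasure r t
  rw [charFun_apply_real, integral_map .of_discrete (by fun_prop)] at h
  have hi : Integrable (fun n : ℕ => Complex.exp (t * (n : ℝ) * Complex.I)) (poissonMeasure r) := by
    refine Integrable.of_bound (C := 1) (by fun_prop) (Eventually.of_forall fun x => ?_)
    rw [← Complex.ofReal_mul, Complex.norm_exp_ofReal_mul_I]
  have ic : Integrable (fun n : ℕ => Real.cos (t * n)) (poissonMeasure r) :=
    Integrable.of_bound (C := 1) (by fun_prop) (Eventually.of_forall fun x => Real.abs_cos_le_one _)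
  have is : Integrable (fun n : ℕ => Real.sin (t * n)) (poissonMeasure r) :=
    Integrable.of_bound (C := 1) (by fun_prop) (Eventually.of_forall fun x => Real.abs_sin_le_one _)
  have hre : ∫ n : ℕ, Real.cos (t * n) ∂poissonMeasure r
      = (∫ n : ℕ, Complex.exp (t * (n : ℝ) * Complex.I) ∂poissonMeasure r).re := by
    rw [← RCLike.re_eq_complex_re, ← integral_re hi]
    refine integral_congr_ae (Eventually.of_forall fun n => ?_)
    simp only
    rw [RCLike.re_eq_complex_re, ← Complex.ofReal_mul, Complex.exp_ofReal_mul_I_re]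
  have him : ∫ n : ℕ, Real.sin (t * n) ∂poissonMeasure r
      = (∫ n : ℕ, Complex.exp (t * (n : ℝ) * Complex.I) ∂poissonMeasure r).im := by
    rw [← RCLike.im_eq_complex_im, ← integral_im hi]
    refine integral_congr_ae (Eventually.of_forall fun n => ?_)
    simp only
    rw [RCLike.im_eq_complex_im, ← Complex.ofReal_mul, Complex.exp_ofReal_mul_I_im]
  have e : ∀ p : ℕ × ℕ, Real.cos (((p.1 : ℝ) - p.2) * t)
      = Real.cos (t * p.1) * Real.cos (t * p.2) + Real.sin (t * p.1) * Real.sin (t * p.2) := by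
    intro p
    rw [← Real.cos_sub]
    ring_nf
  simp_rw [e]
  rw [integral_add (ic.mul_prod ic) (is.mul_prod is),
    integral_prod_mul (fun n : ℕ => Real.cos (t * n)) (fun n : ℕ => Real.cos (t * n)),
    integral_prod_mul (fun n : ℕ => Real.sin (t * n)) (fun n : ℕ => Real.sin (t * n)),
    hre, him, h, ← Complex.normSq_apply, Complex.normSq_eq_norm_sq, Complex.norm_exp,
    ← Real.exp_nat_mul]
  congr 1
  simp [Complex.exp_ofReal_mul_I_re]
  ring

lemma integrable_natCast_poisson (r : ℝ≥0) :
    Integrable (fun n : ℕ => (n : ℝ)) (poissonMeasure r) := by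
  simpa using integrable_add_pow_poisson r 1 0

lemma cosConst_mul_poissonAbsDiff (r : ℝ≥0) :
    cosConst * (poissonAbsDiff r / √r)
      = ∫ t : ℝ, (1 - Real.exp (-(2 * r * (1 - Real.cos (t / √r))))) / t ^ 2 := by
  have hi : Integrable (fun p : ℕ × ℕ => ((p.1 : ℝ) - p.2) / √(r : ℝ))
      ((poissonMeasure r).prod (poissonMeasure r)) :=
    (((integrable_natCast_poisson r).comp_fst _).sub
      ((integrable_natCast_poisson r).comp_snd _)).div_const _
  have h := cosConst_mul_integral_abs (by fun_prop) hi
  simp_rw [abs_div, abs_of_nonneg (Real.sqrt_nonneg _)] at h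
  rw [integral_div] at h
  rw [poissonAbsDiff, h]
  simp_rw [div_mul_eq_mul_div, mul_div_assoc, integral_cos_poisson_diff]

/-- Dominated convergence: the exponent `2r(1 - cos(t/√r))` tends to `t²` and never exceeds it, so
the integrand is at most `min(2, t²)/t²`. -/
lemma tendsto_poissonAbsDiff_div_sqrt :
    Tendsto (fun r : ℝ => poissonAbsDiff r.toNNReal / √r) atTop (𝓝 (2 / √Real.pi)) := by
  have key : Tendsto (fun r : ℝ => ∫ t : ℝ,
      (1 - Real.exp (-(2 * r * (1 - Real.cos (t / √r))))) / t ^ 2) atTop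
      (𝓝 (∫ t : ℝ, (1 - Real.exp (-t ^ 2)) / t ^ 2)) := by
    refine tendsto_integral_filter_of_dominated_convergence (fun t : ℝ => 4 * (1 + t ^ 2)⁻¹)
      (Eventually.of_forall fun r => ?_) ?_ integrable_two_div_one_add_sq
      (Eventually.of_forall fun t => ?_)
    · exact (by fun_prop : Measurable fun t : ℝ =>
        (1 - Real.exp (-(2 * r * (1 - Real.cos (t / √r))))) / t ^ 2).aestronglyMeasurable
    · filter_upwards [eventually_gt_atTop 0] with r hr
      refine Eventually.of_forall fun t => ?_
      set y := 2 * r * (1 - Real.cos (t / √r)) with hy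
      have hy0 : 0 ≤ y := by
        have := Real.cos_le_one (t / √r)
        have : 0 ≤ 1 - Real.cos (t / √r) := by linarith
        positivity
      have hy1 : y ≤ t ^ 2 := by
        have h1 := Real.one_sub_sq_div_two_le_cos (x := t / √r)
        rw [div_pow, Real.sq_sqrt hr.le] at h1
        have h2 : 1 - Real.cos (t / √r) ≤ t ^ 2 / r / 2 := by linarith
        calc y ≤ 2 * r * (t ^ 2 / r / 2) := by rw [hy]; gcongr
          _ = t ^ 2 := by field_simp
      have h1 : 0 ≤ 1 - Real.exp (-y) := by
        have := Real.exp_le_one_iff.2 (neg_nonpos.2 hy0)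
        linarith
      rw [Real.norm_of_nonneg (div_nonneg h1 (sq_nonneg t))]
      refine div_sq_le_of_le ?_ ?_
      · linarith [Real.exp_pos (-y)]
      · linarith [Real.add_one_le_exp (-y)]
    · have h2 : Tendsto (fun r : ℝ => 2 * r * (1 - Real.cos (t / √r))) atTop (𝓝 (t ^ 2)) := by
        rw [tendsto_iff_dist_tendsto_zero]
        have h0 : Tendsto (fun r : ℝ => t ^ 4 / r) atTop (𝓝 0) :=
          tendsto_const_nhds.div_atTop tendsto_id
        refine squeeze_zero' (Eventually.of_forall fun r => dist_nonneg) ?_ h0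
        -- `r ≥ t²` means `|t/√r| ≤ 1`, the range of the fourth-order cosine bound.
        filter_upwards [eventually_gt_atTop 0, eventually_ge_atTop (t ^ 2)] with r hr hrt
        have hs : √r ^ 2 = r := Real.sq_sqrt hr.le
        have habs : |t / √r| ≤ 1 := by
          rw [abs_le_one_iff_mul_self_le_one, ← sq, div_pow, hs]
          exact (div_le_one hr).2 hrt
        have hb := Real.cos_bound habs
        have e4 : |t / √r| ^ 4 = t ^ 4 / r ^ 2 := by
          rw [(by decide : Even 4).pow_abs, div_pow, show √r ^ 4 = (√r ^ 2) ^ 2 by ring, hs]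
        have e2 : (t / √r) ^ 2 = t ^ 2 / r := by rw [div_pow, hs]
        rw [e4, e2] at hb
        have e : 2 * r * (1 - Real.cos (t / √r)) - t ^ 2
            = -(2 * r) * (Real.cos (t / √r) - (1 - t ^ 2 / r / 2)) := by
          field_simp
          ring
        rw [Real.dist_eq, e, abs_mul, abs_neg, abs_of_pos (by positivity : 0 < 2 * r)]
        calc 2 * r * |Real.cos (t / √r) - (1 - t ^ 2 / r / 2)|
            ≤ 2 * r * (t ^ 4 / r ^ 2 * (5 / 96)) := by gcongr
          _ = t ^ 4 / r * (10 / 96) := by field_simp; ring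
          _ ≤ t ^ 4 / r * 1 := by gcongr; norm_num
          _ = t ^ 4 / r := mul_one _
      have := ((Real.continuous_exp.tendsto _).comp h2.neg)
      exact (tendsto_const_nhds.sub this).div_const _
  rw [integral_one_sub_exp_neg_sq_div_sq] at key
  have h := key.const_mul cosConst⁻¹
  rw [inv_mul_cancel_left₀ cosConst_pos.ne'] at h
  refine h.congr' ?_
  filter_upwards [eventually_gt_atTop 0] with r hr
  have h1 := cosConst_mul_poissonAbsDiff r.toNNReal
  rw [Real.coe_toNNReal r hr.le] at h1
  rw [← h1, inv_mul_cancel_left₀ cosConst_pos.ne']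

end AbsoluteMoment

/-! ### Taylor expansions with remainders uniform over a compact set of base points. -/

section Taylor

variable {d : ℕ}

lemma isOpen_posOrthant (d : ℕ) : IsOpen (posOrthant d) := by
  have : posOrthant d = ⋂ j, (fun x : Fin d → ℝ => x j) ⁻¹' Set.Ioi 0 := by
    ext x; simp [posOrthant]
  rw [this]
  exact isOpen_iInter_of_finite fun j => isOpen_Ioi.preimage (continuous_apply j)

variable {F : (Fin d → ℝ) → ℝ}

lemma InteriorC2.contDiffAt (hF : InteriorC2 F) {x : Fin d → ℝ} (hx : x ∈ posOrthant d) :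
    ContDiffAt ℝ 2 F x :=
  hF.contDiffOn.contDiffAt ((isOpen_posOrthant d).mem_nhds hx)

lemma InteriorC2.differentiableAt (hF : InteriorC2 F) {x : Fin d → ℝ} (hx : x ∈ posOrthant d) :
    DifferentiableAt ℝ F x :=
  (hF.contDiffAt hx).differentiableAt (by norm_num)

lemma InteriorC2.contDiffAt_fderiv (hF : InteriorC2 F) {x : Fin d → ℝ}
    (hx : x ∈ posOrthant d) : ContDiffAt ℝ 1 (fderiv ℝ F) x :=
  (hF.contDiffAt hx).fderiv_right (by norm_num)

lemma InteriorC2.differentiableAt_fderiv (hF : InteriorC2 F) {x : Fin d → ℝ}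
    (hx : x ∈ posOrthant d) : DifferentiableAt ℝ (fderiv ℝ F) x :=
  (hF.contDiffAt_fderiv hx).differentiableAt (by norm_num)

lemma InteriorC2.continuousAt_fderiv_fderiv (hF : InteriorC2 F) {x : Fin d → ℝ}
    (hx : x ∈ posOrthant d) : ContinuousAt (fderiv ℝ (fderiv ℝ F)) x :=
  ((hF.contDiffAt_fderiv hx).fderiv_right (m := 0) (by norm_num)).continuousAt

lemma InteriorC2.partialDeriv_eq (hF : InteriorC2 F) (j : Fin d) {x : Fin d → ℝ}
    (hx : x ∈ posOrthant d) : partialDeriv j F x = fderiv ℝ F x (Pi.single j 1) :=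
  (hF.differentiableAt hx).lineDeriv_eq_fderiv

lemma InteriorC2.partialDeriv₂_eq (hF : InteriorC2 F) (i j : Fin d) {x : Fin d → ℝ}
    (hx : x ∈ posOrthant d) :
    partialDeriv₂ i j F x = fderiv ℝ (fderiv ℝ F) x (Pi.single i 1) (Pi.single j 1) := by
  have h1 : partialDeriv j F =ᶠ[𝓝 x] fun y => fderiv ℝ F y (Pi.single j 1) := by
    filter_upwards [(isOpen_posOrthant d).mem_nhds hx] with y hy using hF.partialDeriv_eq j hy
  have h2 : HasFDerivAt (fun y => fderiv ℝ F y (Pi.single j 1))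
      ((fderiv ℝ (fderiv ℝ F) x).flip (Pi.single j 1)) x := by
    have := (hF.differentiableAt_fderiv hx).hasFDerivAt.clm_apply
      (hasFDerivAt_const (Pi.single j (1 : ℝ)) x)
    simpa using this
  rw [partialDeriv₂, partialDeriv, h1.lineDeriv_eq, h2.differentiableAt.lineDeriv_eq_fderiv,
    h2.fderiv]
  rfl

lemma clm_apply_eq_sum {G : Type*} [NormedAddCommGroup G] [NormedSpace ℝ G]
    (L : (Fin d → ℝ) →L[ℝ] G) (u : Fin d → ℝ) : L u = ∑ j, u j • L (Pi.single j 1) := by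
  conv_lhs => rw [← Finset.univ_sum_single u]
  rw [map_sum]
  refine Finset.sum_congr rfl fun j _ => ?_
  rw [← map_smul, ← Pi.single_smul, smul_eq_mul, mul_one]

/-- The first-order term of the Taylor expansion of `F` at `x`. -/
noncomputable def taylorOne (F : (Fin d → ℝ) → ℝ) (x u : Fin d → ℝ) : ℝ := ∑ j, partialDeriv j F x * u j

/-- The second-order term of the Taylor expansion of `F` at `x`. -/
noncomputable def taylorTwo (F : (Fin d → ℝ) → ℝ) (x u : Fin d → ℝ) : ℝ :=
  (1 / 2) * ∑ i, ∑ j, partialDeriv₂ i j F x * (u i * u j)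

lemma InteriorC2.taylorOne_eq (hF : InteriorC2 F) {x : Fin d → ℝ} (hx : x ∈ posOrthant d)
    (u : Fin d → ℝ) : taylorOne F x u = fderiv ℝ F x u := by
  rw [clm_apply_eq_sum, taylorOne]
  refine Finset.sum_congr rfl fun j _ => ?_
  rw [hF.partialDeriv_eq j hx, smul_eq_mul, mul_comm]

lemma InteriorC2.taylorTwo_eq (hF : InteriorC2 F) {x : Fin d → ℝ} (hx : x ∈ posOrthant d)
    (u : Fin d → ℝ) : taylorTwo F x u = (1 / 2) * fderiv ℝ (fderiv ℝ F) x u u := by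
  rw [clm_apply_eq_sum (fderiv ℝ (fderiv ℝ F) x), taylorTwo, _root_.sum_apply]
  congr 1
  refine Finset.sum_congr rfl fun i _ => ?_
  rw [_root_.smul_apply, clm_apply_eq_sum, smul_eq_mul, Finset.mul_sum]
  refine Finset.sum_congr rfl fun j _ => ?_
  rw [hF.partialDeriv₂_eq i j hx, smul_eq_mul]
  ring

/-- Second-order Taylor estimate along a segment on which the Hessian varies by at most `ε`. -/
lemma InteriorC2.taylor_local (hF : InteriorC2 F) {x u : Fin d → ℝ} {ε : ℝ}
    (hseg : ∀ t ∈ Set.Icc (0 : ℝ) 1, x + t • u ∈ posOrthant d)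
    (hε : ∀ t ∈ Set.Icc (0 : ℝ) 1,
      ‖fderiv ℝ (fderiv ℝ F) (x + t • u) - fderiv ℝ (fderiv ℝ F) x‖ ≤ ε) :
    |F (x + u) - F x - taylorOne F x u - taylorTwo F x u| ≤ ε * ‖u‖ ^ 2 := by
  have hx : x ∈ posOrthant d := by simpa using hseg 0 (by simp)
  have hε0 : 0 ≤ ε := le_trans (norm_nonneg (fderiv ℝ (fderiv ℝ F) (x + (0 : ℝ) • u) -
    fderiv ℝ (fderiv ℝ F) x)) (hε 0 (by simp))
  have hline : ∀ t : ℝ, HasDerivAt (fun s : ℝ => x + s • u) u t := fun t => by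
    simpa using ((hasDerivAt_id t).smul_const u).const_add x
  set D := fderiv ℝ F
  set H := fderiv ℝ D
  -- Along the segment the remainder (up to the constant `F x`) has second derivative at most
  -- `ε‖u‖²`. The mean value inequality is applied twice, to its derivative and then to itself; the
  -- factor `1/2` is given up.
  have h1 : ∀ t ∈ Set.Icc (0 : ℝ) 1,
      HasDerivWithinAt (fun s => F (x + s • u) - s * D x u - s ^ 2 / 2 * H x u u)
        (D (x + t • u) u - D x u - t * H x u u) (Set.Icc 0 1) t := by
    intro t ht
    have a : HasDerivAt (fun s => F (x + s • u)) (D (x + t • u) u) t :=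
      (hF.differentiableAt (hseg t ht)).hasFDerivAt.comp_hasDerivAt t (hline t)
    have b : HasDerivAt (fun s : ℝ => s * D x u) (D x u) t := by
      simpa using (hasDerivAt_id t).mul_const (D x u)
    have c : HasDerivAt (fun s : ℝ => s ^ 2 / 2 * H x u u) (t * H x u u) t := by
      have := (((hasDerivAt_id t).pow 2).div_const 2).mul_const (H x u u)
      convert! this using 1
      simp
    exact ((a.sub b).sub c).hasDerivWithinAt
  have h2 : ∀ t ∈ Set.Icc (0 : ℝ) 1,
      HasDerivWithinAt (fun s => D (x + s • u) u - D x u - s * H x u u)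
        (H (x + t • u) u u - H x u u) (Set.Icc 0 1) t := by
    intro t ht
    have a : HasDerivAt (fun s => D (x + s • u)) (H (x + t • u) u) t :=
      (hF.differentiableAt_fderiv (hseg t ht)).hasFDerivAt.comp_hasDerivAt t (hline t)
    have a' : HasDerivAt (fun s => D (x + s • u) u) (H (x + t • u) u u) t := by
      simpa using a.clm_apply (hasDerivAt_const t u)
    have b : HasDerivAt (fun s : ℝ => s * H x u u) (H x u u) t := by
      simpa using (hasDerivAt_id t).mul_const (H x u u)
    exact ((a'.sub_const (D x u)).sub b).hasDerivWithinAt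
  have b2 : ∀ t ∈ Set.Ico (0 : ℝ) 1, ‖H (x + t • u) u u - H x u u‖ ≤ ε * ‖u‖ ^ 2 := by
    intro t ht
    have : H (x + t • u) u u - H x u u = (H (x + t • u) - H x) u u := by simp
    rw [this]
    calc _ ≤ ‖H (x + t • u) - H x‖ * ‖u‖ * ‖u‖ := ContinuousLinearMap.le_opNorm₂ _ _ _
      _ ≤ ε * ‖u‖ * ‖u‖ := by gcongr; exact hε t ⟨ht.1, ht.2.le⟩
      _ = _ := by ring
  have b1 : ∀ t ∈ Set.Icc (0 : ℝ) 1, ‖D (x + t • u) u - D x u - t * H x u u‖ ≤ ε * ‖u‖ ^ 2 := by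
    intro t ht
    have := norm_image_sub_le_of_norm_deriv_le_segment' h2 b2 t ht
    simp only [zero_smul, add_zero, sub_self, zero_mul, sub_zero] at this
    refine this.trans ?_
    exact mul_le_of_le_one_right (by positivity) ht.2
  have := norm_image_sub_le_of_norm_deriv_le_segment' h1
    (fun t ht => b1 t ⟨ht.1, ht.2.le⟩) 1 (by simp)
  rw [hF.taylorOne_eq hx, hF.taylorTwo_eq hx]
  simp only [one_smul, zero_smul, add_zero, sub_zero, mul_one, Real.norm_eq_abs] at this
  convert! this using 2
  simp only [D, H]
  ring

lemma InteriorC2.partialDeriv_bound (hF : InteriorC2 F) {S : Set (Fin d → ℝ)} (hS : IsCompact S)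
    (hSp : S ⊆ posOrthant d) : ∃ M, 0 ≤ M ∧ ∀ x ∈ S,
      (∀ i, |partialDeriv i F x| ≤ M) ∧ (∀ i j, |partialDeriv₂ i j F x| ≤ M) := by
  obtain ⟨δ, hδ, M, hM⟩ := hF.bounds S hS hSp
  refine ⟨max M 0, le_max_right _ _, fun x hx => ?_⟩
  have := hM x ⟨hSp hx, x, hx, by simpa using hδ.le⟩
  exact ⟨fun i => (this.1 i).trans (le_max_left _ _),
    fun i j => (this.2 i j).trans (le_max_left _ _)⟩

lemma abs_taylorOne_le {M : ℝ} {x : Fin d → ℝ} (hM : ∀ i, |partialDeriv i F x| ≤ M)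
    (u : Fin d → ℝ) : |taylorOne F x u| ≤ M * ∑ j, |u j| := by
  rw [taylorOne, Finset.mul_sum]
  refine (Finset.abs_sum_le_sum_abs _ _).trans (Finset.sum_le_sum fun j _ => ?_)
  rw [abs_mul]
  gcongr
  exact hM j

lemma abs_taylorTwo_le {M : ℝ} {x : Fin d → ℝ} (hM0 : 0 ≤ M)
    (hM : ∀ i j, |partialDeriv₂ i j F x| ≤ M) (u : Fin d → ℝ) :
    |taylorTwo F x u| ≤ M * d * ∑ j, u j ^ 2 := by
  have h1 : |∑ i, ∑ j, partialDeriv₂ i j F x * (u i * u j)|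
      ≤ ∑ i, ∑ j, M * ((u i ^ 2 + u j ^ 2) / 2) := by
    refine (Finset.abs_sum_le_sum_abs _ _).trans (Finset.sum_le_sum fun i _ => ?_)
    refine (Finset.abs_sum_le_sum_abs _ _).trans (Finset.sum_le_sum fun j _ => ?_)
    rw [abs_mul]
    gcongr
    · exact hM i j
    · rw [abs_mul, ← sq_abs (u i), ← sq_abs (u j)]
      nlinarith [sq_nonneg (|u i| - |u j|)]
  have h2 : ∑ i : Fin d, ∑ j : Fin d, M * ((u i ^ 2 + u j ^ 2) / 2) = M * d * ∑ j, u j ^ 2 := by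
    simp_rw [← Finset.mul_sum, ← Finset.sum_div, Finset.sum_add_distrib]
    simp only [Finset.sum_const, Finset.card_univ, Fintype.card_fin, nsmul_eq_mul,
      ← Finset.mul_sum]
    ring
  rw [taylorTwo, abs_mul, abs_of_pos (by norm_num : (0 : ℝ) < 1 / 2)]
  have h3 : 0 ≤ M * d * ∑ j, u j ^ 2 := by positivity
  linarith

/-- The norm is the sup norm. Remainders are stated with coordinate power sums because their Poisson
expectations are explicit. -/
lemma norm_sq_le_sum_sq (u : Fin d → ℝ) : ‖u‖ ^ 2 ≤ ∑ j, u j ^ 2 := by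
  have : ‖u‖ ≤ √(∑ j, u j ^ 2) := by
    refine (pi_norm_le_iff_of_nonneg (Real.sqrt_nonneg _)).2 fun j => ?_
    rw [Real.norm_eq_abs, ← Real.sqrt_sq_eq_abs]
    exact Real.sqrt_le_sqrt (Finset.single_le_sum (f := fun j => u j ^ 2)
      (fun i _ => sq_nonneg _) (Finset.mem_univ j))
  calc ‖u‖ ^ 2 ≤ √(∑ j, u j ^ 2) ^ 2 := by gcongr
    _ = _ := Real.sq_sqrt (Finset.sum_nonneg fun i _ => sq_nonneg _)

lemma norm_pow_four_le_sum (u : Fin d → ℝ) : ‖u‖ ^ 4 ≤ ∑ j, u j ^ 4 := by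
  have h : ‖u‖ ≤ √‖fun j => u j ^ 2‖ := by
    refine (pi_norm_le_iff_of_nonneg (Real.sqrt_nonneg _)).2 fun j => ?_
    rw [Real.norm_eq_abs, ← Real.sqrt_sq_eq_abs]
    refine Real.sqrt_le_sqrt ?_
    have := norm_le_pi_norm (fun j => u j ^ 2) j
    rwa [Real.norm_of_nonneg (sq_nonneg _)] at this
  calc ‖u‖ ^ 4 ≤ √‖fun j => u j ^ 2‖ ^ 4 := by gcongr
    _ = (√‖fun j => u j ^ 2‖ ^ 2) ^ 2 := by ring
    _ = ‖fun j => u j ^ 2‖ ^ 2 := by rw [Real.sq_sqrt (norm_nonneg _)]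
    _ ≤ ∑ j, (u j ^ 2) ^ 2 := norm_sq_le_sum_sq _
    _ = ∑ j, u j ^ 4 := by simp_rw [← pow_mul]

/-- Global second-order Taylor estimate, uniform over base points in a compact set. -/
lemma InteriorC2.taylor_two (hF : InteriorC2 F) (hF1 : ∀ x y, |F y - F x| ≤ 1)
    {S : Set (Fin d → ℝ)} (hS : IsCompact S) (hSp : S ⊆ posOrthant d) {ε : ℝ} (hε : 0 < ε) :
    ∃ C, 0 ≤ C ∧ ∀ x ∈ S, ∀ u,
      |F (x + u) - F x - taylorOne F x u - taylorTwo F x u|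
        ≤ ε * ∑ j, u j ^ 2 + C * ∑ j, u j ^ 4 := by
  obtain ⟨M, hM0, hM⟩ := hF.partialDeriv_bound hS hSp
  obtain ⟨δ₁, hδ₁, hball⟩ := hS.exists_thickening_subset_open (isOpen_posOrthant d) hSp
  have huc := hS.uniformContinuousAt_of_continuousAt (fderiv ℝ (fderiv ℝ F))
    (fun x hx => hF.continuousAt_fderiv_fderiv (hSp hx)) 
    (Metric.dist_mem_uniformity (α := (Fin d → ℝ) →L[ℝ] (Fin d → ℝ) →L[ℝ] ℝ) hε)
  obtain ⟨δ₂, hδ₂, huc⟩ := Metric.mem_uniformity_dist.1 huc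
  set δ := min δ₁ δ₂ with hδdef
  have hδ : 0 < δ := lt_min hδ₁ hδ₂
  -- Constant parts, for large `u`, of the bounds on the increment of `F`, the linear term and the
  -- quadratic term.
  set K := 1 + M * d + M * d * d
  have hK : 0 ≤ K := by positivity
  refine ⟨K / δ ^ 4 + M + M * d, by positivity, fun x hx u => ?_⟩
  have s2 : 0 ≤ ∑ j, u j ^ 2 := Finset.sum_nonneg fun i _ => sq_nonneg _
  have s4 : 0 ≤ ∑ j, u j ^ 4 := Finset.sum_nonneg fun i _ => by positivity
  rcases lt_or_ge ‖u‖ δ with hu | hu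
  · have hd : ∀ t ∈ Set.Icc (0 : ℝ) 1, dist x (x + t • u) < δ := by
      intro t ht
      rw [dist_self_add_right, norm_smul, Real.norm_of_nonneg ht.1]
      exact (mul_le_of_le_one_left (norm_nonneg _) ht.2).trans_lt hu
    have := hF.taylor_local (x := x) (u := u) (ε := ε) (fun t ht => hball ?_) (fun t ht => ?_)
    · calc _ ≤ ε * ‖u‖ ^ 2 := this
        _ ≤ ε * ∑ j, u j ^ 2 := by gcongr; exact norm_sq_le_sum_sq u
        _ ≤ _ := le_add_of_nonneg_right (by positivity)
    · rw [Metric.mem_thickening_iff]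
      refine ⟨x, hx, ?_⟩
      rw [dist_comm]
      exact (hd t ht).trans_le (min_le_left _ _)
    · have h : dist (fderiv ℝ (fderiv ℝ F) x) (fderiv ℝ (fderiv ℝ F) (x + t • u)) < ε :=
        huc ((hd t ht).trans_le (min_le_right _ _)) hx
      rw [dist_comm] at h
      exact ((dist_eq_norm (fderiv ℝ (fderiv ℝ F) (x + t • u)) _).symm.trans_lt h).le
  -- Far from `x` nothing is known but `|F(x+u) - F(x)| ≤ 1`. There constants are paid for by fourth
  -- powers, whose expectation is only `O(m⁻²)`.
  · have h1 : 1 ≤ (∑ j, u j ^ 4) / δ ^ 4 := by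
      rw [one_le_div (by positivity)]
      exact (pow_le_pow_left₀ hδ.le hu 4).trans (norm_pow_four_le_sum u)
    have a1 : ∑ j, |u j| ≤ d + ∑ j, u j ^ 4 := by
      have : ∑ j, |u j| ≤ ∑ j, (1 + u j ^ 4) := Finset.sum_le_sum fun j _ => by
        have : u j ^ 4 = |u j| ^ 4 := ((by decide : Even 4).pow_abs _).symm
        rw [this]
        nlinarith [sq_nonneg (|u j| ^ 2 - 1), sq_nonneg (|u j| - 1), sq_nonneg (|u j|)]
      simpa [Finset.sum_add_distrib] using this
    have a2 : ∑ j, u j ^ 2 ≤ d + ∑ j, u j ^ 4 := by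
      have : ∑ j, u j ^ 2 ≤ ∑ j, (1 + u j ^ 4) := Finset.sum_le_sum fun j _ => by
        nlinarith [sq_nonneg (u j ^ 2 - 1), sq_nonneg (u j)]
      simpa [Finset.sum_add_distrib] using this
    have b1 := (abs_taylorOne_le (hM x hx).1 u).trans (mul_le_mul_of_nonneg_left a1 hM0)
    have b2 := (abs_taylorTwo_le hM0 (hM x hx).2 u).trans
      (mul_le_mul_of_nonneg_left a2 (by positivity : 0 ≤ M * d))
    have b0 := hF1 x (x + u)
    calc |F (x + u) - F x - taylorOne F x u - taylorTwo F x u|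
        ≤ |F (x + u) - F x| + |taylorOne F x u| + |taylorTwo F x u| :=
          (abs_sub _ _).trans (add_le_add_left (abs_sub _ _) _)
      _ ≤ 1 + M * (d + ∑ j, u j ^ 4) + M * d * (d + ∑ j, u j ^ 4) := by linarith
      _ = K * 1 + (M + M * d) * ∑ j, u j ^ 4 := by ring
      _ ≤ K * ((∑ j, u j ^ 4) / δ ^ 4) + (M + M * d) * ∑ j, u j ^ 4 := by gcongr
      _ = (K / δ ^ 4 + M + M * d) * ∑ j, u j ^ 4 := by ring
      _ ≤ _ := le_add_of_nonneg_left (by positivity)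

/-- Global first-order Taylor estimate, uniform over base points in a compact set. -/
lemma InteriorC2.taylor_one (hF : InteriorC2 F) (hF1 : ∀ x y, |F y - F x| ≤ 1)
    {S : Set (Fin d → ℝ)} (hS : IsCompact S) (hSp : S ⊆ posOrthant d) :
    ∃ C, 0 ≤ C ∧ ∀ x ∈ S, ∀ u,
      |F (x + u) - F x - taylorOne F x u| ≤ C * ∑ j, u j ^ 2 := by
  obtain ⟨M, hM0, hM⟩ := hF.partialDeriv_bound hS hSp
  obtain ⟨C, hC, h⟩ := hF.taylor_two hF1 hS hSp one_pos
  -- The first bracket serves `‖u‖ ≤ 1`, where fourth powers are at most squares; the second serves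
  -- `‖u‖ > 1`, where `1 ≤ ∑ u_j²`.
  refine ⟨(1 + C + M * d) + (1 + M * d + M), by positivity, fun x hx u => ?_⟩
  have s2 : 0 ≤ ∑ j, u j ^ 2 := Finset.sum_nonneg fun i _ => sq_nonneg _
  rcases le_or_gt ‖u‖ 1 with hu | hu
  · have a4 : ∑ j, u j ^ 4 ≤ ∑ j, u j ^ 2 := Finset.sum_le_sum fun j _ => by
      have h1 : |u j| ≤ 1 := (norm_le_pi_norm u j).trans hu
      have h2 : u j ^ 2 ≤ 1 := (sq_le_one_iff_abs_le_one _).2 h1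
      nlinarith [sq_nonneg (u j)]
    have b2 := abs_taylorTwo_le hM0 (hM x hx).2 u
    have b3 := h x hx u
    have b4 : C * ∑ j, u j ^ 4 ≤ C * ∑ j, u j ^ 2 := by gcongr
    have b5 : |F (x + u) - F x - taylorOne F x u|
        ≤ |F (x + u) - F x - taylorOne F x u - taylorTwo F x u| + |taylorTwo F x u| := by
      have := abs_add_le (F (x + u) - F x - taylorOne F x u - taylorTwo F x u) (taylorTwo F x u)
      simpa using this
    have b6 : 0 ≤ (1 + M * d + M) * ∑ j, u j ^ 2 := by positivity
    linarith
  · have h1 : 1 ≤ ∑ j, u j ^ 2 :=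
      (one_le_pow₀ hu.le).trans (norm_sq_le_sum_sq u)
    have a1 : ∑ j, |u j| ≤ d + ∑ j, u j ^ 2 := by
      have : ∑ j, |u j| ≤ ∑ j, (1 + u j ^ 2) := Finset.sum_le_sum fun j _ => by
        rw [← sq_abs]
        nlinarith [sq_nonneg (|u j| - 1), sq_nonneg (|u j|)]
      simpa [Finset.sum_add_distrib] using this
    have b1 := (abs_taylorOne_le (hM x hx).1 u).trans (mul_le_mul_of_nonneg_left a1 hM0)
    have b0 := hF1 x (x + u)
    calc |F (x + u) - F x - taylorOne F x u|
        ≤ |F (x + u) - F x| + |taylorOne F x u| := abs_sub _ _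
      _ ≤ (1 + M * d) * 1 + M * ∑ j, u j ^ 2 := by linarith
      _ ≤ (1 + M * d) * ∑ j, u j ^ 2 + M * ∑ j, u j ^ 2 := by gcongr
      _ = (1 + M * d + M) * ∑ j, u j ^ 2 := by ring
      _ ≤ _ := by
        rw [add_mul (1 + C + M * d)]
        exact le_add_of_nonneg_left (by positivity)

end Taylor

/-! ### Exact variance and bias of the estimator through Poisson averages. -/

section MseDecomposition

/-- Mean squared error of an average of i.i.d. bounded variables `g (X i)`. -/
lemma integral_average_sub_sq {Ω 𝓧 : Type*} [MeasurableSpace Ω] [MeasurableSpace 𝓧]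
    {P : Measure Ω} [IsProbabilityMeasure P] {μ : Measure 𝓧} [IsProbabilityMeasure μ]
    {X : ℕ → Ω → 𝓧} (hlaw : ∀ i, HasLaw (X i) μ P) (hindep : iIndepFun X P)
    {g : 𝓧 → ℝ} (hg : Measurable g) {C : ℝ} (hC : ∀ y, |g y| ≤ C) (a : ℝ) {n : ℕ} (hn : n ≠ 0) :
    ∫ ω, ((n : ℝ)⁻¹ * ∑ i ∈ Finset.range n, g (X i ω) - a) ^ 2 ∂P
      = (n : ℝ)⁻¹ * (∫ y, g y ^ 2 ∂μ - (∫ y, g y ∂μ) ^ 2) + (∫ y, g y ∂μ - a) ^ 2 := by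
  have hn' : (n : ℝ) ≠ 0 := by exact_mod_cast hn
  have hmem : ∀ i, MemLp (fun ω => g (X i ω)) 2 P := fun i =>
    MemLp.of_bound (hg.comp_aemeasurable (hlaw i).aemeasurable).aestronglyMeasurable C
      (Eventually.of_forall fun ω => hC _)
  have hlawg : ∀ i, ∫ ω, g (X i ω) ∂P = ∫ y, g y ∂μ := fun i =>
    (hlaw i).integral_comp hg.aestronglyMeasurable
  have hlawg2 : ∀ i, ∫ ω, g (X i ω) ^ 2 ∂P = ∫ y, g y ^ 2 ∂μ := fun i =>
    (hlaw i).integral_comp (f := fun y => g y ^ 2) (hg.pow_const 2).aestronglyMeasurable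
  have hvar : ∀ i, Var[fun ω => g (X i ω); P] = ∫ y, g y ^ 2 ∂μ - (∫ y, g y ∂μ) ^ 2 := by
    intro i
    rw [variance_eq_sub (hmem i)]
    simp only [Pi.pow_apply]
    rw [hlawg, hlawg2]
  set A : Ω → ℝ := fun ω => (n : ℝ)⁻¹ * ∑ i ∈ Finset.range n, g (X i ω) with hA
  have hsum : Var[∑ i ∈ Finset.range n, fun ω => g (X i ω); P]
      = n * (∫ y, g y ^ 2 ∂μ - (∫ y, g y ∂μ) ^ 2) := by
    rw [IndepFun.variance_sum (fun i _ => hmem i)]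
    · simp_rw [hvar]
      simp
      ring
    · intro i _ j _ hij
      exact (hindep.indepFun hij).comp hg hg
  have hAL : MemLp A 2 P := (memLp_finsetSum _ fun i _ => hmem i).const_mul _
  have hAvar : Var[A; P] = (n : ℝ)⁻¹ * (∫ y, g y ^ 2 ∂μ - (∫ y, g y ∂μ) ^ 2) := by
    have : A = fun ω => (n : ℝ)⁻¹ * (∑ i ∈ Finset.range n, fun ω => g (X i ω)) ω := by
      ext ω; simp [hA]
    rw [this, variance_const_mul, hsum]
    field_simp
  have hAint : ∫ ω, A ω ∂P = ∫ y, g y ∂μ := by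
    simp only [hA]
    rw [integral_const_mul, integral_finsetSum _ fun i _ => (hmem i).integrable one_le_two]
    simp [hlawg, hn']
  have hA1 : Integrable A P := hAL.integrable one_le_two
  have hA2 : Integrable (fun ω => A ω ^ 2) P := hAL.integrable_sq
  have e : ∀ ω, (A ω - a) ^ 2 = A ω ^ 2 + (-2 * a * A ω + a ^ 2) := fun ω => by ring
  have hv := variance_eq_sub hAL
  simp only [Pi.pow_apply] at hv
  have i1 : Integrable (fun ω => -2 * a * A ω + a ^ 2) P :=
    (hA1.const_mul _).add (integrable_const _)
  calc ∫ ω, (A ω - a) ^ 2 ∂P = ∫ ω, (A ω ^ 2 + (-2 * a * A ω + a ^ 2)) ∂P := by simp_rw [e]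
    _ = ∫ ω, A ω ^ 2 ∂P + (-2 * a * ∫ ω, A ω ∂P + a ^ 2) := by
      rw [integral_add hA2 i1, integral_add (hA1.const_mul _) (integrable_const _),
        integral_const_mul]
      simp
    _ = _ := by
      rw [← hAvar, hv, hAint]
      ring

variable {d : ℕ}

lemma measurable_measureReal_le {K : Type*} [MeasurableSpace K] {ρ : Measure K}
    [IsProbabilityMeasure ρ] {T : K → Fin d → ℝ} (hT : Measurable T) :
    Measurable fun y : Fin d → ℝ => ρ.real {k | y ≤ T k} := by
  have hs : MeasurableSet {p : (Fin d → ℝ) × K | p.1 ≤ T p.2} :=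
    measurableSet_le measurable_fst (hT.comp measurable_snd)
  exact (measurable_measure_prodMk_left hs).ennreal_toReal

/-- Fubini's theorem for `1{y ≤ T k}`. -/
lemma integral_measureReal_le {K : Type*} [MeasurableSpace K] {ρ : Measure K}
    [IsProbabilityMeasure ρ] {μ : Measure (Fin d → ℝ)} [IsProbabilityMeasure μ]
    {T : K → Fin d → ℝ} (hT : Measurable T) :
    ∫ y, ρ.real {k | y ≤ T k} ∂μ = ∫ k, distFun μ (T k) ∂ρ := by
  have hs : MeasurableSet {p : (Fin d → ℝ) × K | p.1 ≤ T p.2} :=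
    measurableSet_le measurable_fst (hT.comp measurable_snd)
  have h1 := integral_integral_swap (μ := μ) (ν := ρ) (f := fun y k =>
    Set.indicator {p : (Fin d → ℝ) × K | p.1 ≤ T p.2} (1 : (Fin d → ℝ) × K → ℝ) (y, k))
    ((integrable_const (1 : ℝ)).indicator hs)
  have e1 : ∀ y, ∫ k, Set.indicator {p : (Fin d → ℝ) × K | p.1 ≤ T p.2}
      (1 : (Fin d → ℝ) × K → ℝ) (y, k) ∂ρ = ρ.real {k | y ≤ T k} := fun y =>
    integral_indicator_one (μ := ρ) (s := {k | y ≤ T k}) (measurable_prodMk_left hs)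
  have e2 : ∀ k, ∫ y, Set.indicator {p : (Fin d → ℝ) × K | p.1 ≤ T p.2}
      (1 : (Fin d → ℝ) × K → ℝ) (y, k) ∂μ = distFun μ (T k) := fun k =>
    integral_indicator_one (μ := μ) (s := Set.Iic (T k)) measurableSet_Iic
  simp_rw [e1, e2] at h1
  exact h1

/-- The law of `d` independent Poisson variables with means `m x_j`. -/
noncomputable def poissonPi (m : ℝ) (x : Fin d → ℝ) : Measure (Fin d → ℕ) :=
  Measure.pi fun j => poissonMeasure (m * x j).toNNReal

instance (m : ℝ) (x : Fin d → ℝ) : IsProbabilityMeasure (poissonPi m x) := by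
  unfold poissonPi; infer_instance

/-- The grid point `k / m`. -/
noncomputable def grid (m : ℝ) (k : Fin d → ℕ) : Fin d → ℝ := fun j => (k j : ℝ) / m

lemma poissonWeight_eq {m : ℝ} (hm : 0 < m) {x : Fin d → ℝ} (hx : x ∈ posOrthant d)
    (k : Fin d → ℕ) : poissonWeight (fun _ => m) x k = (poissonPi m x).real {k} := by
  rw [poissonPi, measureReal_def, Measure.pi_singleton, ENNReal.toReal_prod, poissonWeight]
  refine Finset.prod_congr rfl fun j _ => ?_
  rw [← measureReal_def, poissonMeasure_real_singleton,
    Real.coe_toNNReal _ (mul_pos hm (hx j)).le]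

/-- The expected empirical distribution function at a random grid point. -/
noncomputable def smoothCdf (μ : Measure (Fin d → ℝ)) (m : ℝ) (x : Fin d → ℝ) : ℝ :=
  ∫ k, distFun μ (grid m k) ∂poissonPi m x

/-- The second moment of the smoothed indicator of `{X ≤ x}`. -/
noncomputable def smoothCdfMin (μ : Measure (Fin d → ℝ)) (m : ℝ) (x : Fin d → ℝ) : ℝ :=
  ∫ p, distFun μ (grid m p.1 ⊓ grid m p.2) ∂(poissonPi m x).prod (poissonPi m x)

/-- Exchanging the sample average with the Poisson sum exhibits an average of one fixed function,
with values in `[0,1]`, of the observations. -/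
lemma estimator_eq (X : ℕ → Fin d → ℝ) (n : ℕ) {m : ℝ} (hm : 0 < m) {x : Fin d → ℝ}
    (hx : x ∈ posOrthant d) :
    estimator X n (fun _ => m) x
      = (n : ℝ)⁻¹ * ∑ i ∈ Finset.range n, (poissonPi m x).real {k | X i ≤ grid m k} := by
  classical
  have hi : ∀ i, Integrable (fun k => Set.indicator {k | X i ≤ grid m k}
      (1 : (Fin d → ℕ) → ℝ) k) (poissonPi m x) := fun i =>
    (integrable_const (1 : ℝ)).indicator .of_discrete
  have h1 : ∀ k, empiricalCdf X n (grid m k)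
      = (n : ℝ)⁻¹ * ∑ i ∈ Finset.range n, Set.indicator {k | X i ≤ grid m k}
        (1 : (Fin d → ℕ) → ℝ) k := by
    intro k
    rw [empiricalCdf]
    congr 1
  have hint : Integrable (fun k => empiricalCdf X n (grid m k)) (poissonPi m x) := by
    simp_rw [h1]
    exact (integrable_finsetSum _ fun i _ => hi i).const_mul _
  have h2 : estimator X n (fun _ => m) x = ∫ k, empiricalCdf X n (grid m k) ∂poissonPi m x := by
    rw [integral_countable hint, estimator]
    refine tsum_congr fun k => ?_
    rw [poissonWeight_eq hm hx, smul_eq_mul, mul_comm]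
    rfl
  rw [h2]
  simp_rw [h1]
  rw [integral_const_mul, integral_finsetSum _ fun i _ => hi i]
  congr 1
  refine Finset.sum_congr rfl fun i _ => ?_
  exact integral_indicator_one .of_discrete

/-- Decomposition of the mean squared error into variance and squared bias. -/
lemma mse_eq {Ω : Type*} [MeasurableSpace Ω] {P : Measure Ω} [IsProbabilityMeasure P]
    {μ : Measure (Fin d → ℝ)} [IsProbabilityMeasure μ] {X : ℕ → Ω → Fin d → ℝ}
    (hlaw : ∀ i, HasLaw (X i) μ P) (hindep : iIndepFun X P) {n : ℕ} (hn : n ≠ 0) {m : ℝ}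
    (hm : 0 < m) {x : Fin d → ℝ} (hx : x ∈ posOrthant d) :
    mse P X (distFun μ) x n m
      = (n : ℝ)⁻¹ * (smoothCdfMin μ m x - smoothCdf μ m x ^ 2)
        + (smoothCdf μ m x - distFun μ x) ^ 2 := by
  have hT : Measurable (grid m : (Fin d → ℕ) → Fin d → ℝ) := .of_discrete
  have h := integral_average_sub_sq hlaw hindep
    (measurable_measureReal_le (ρ := poissonPi m x) hT) (C := 1)
    (fun y => by rw [abs_of_nonneg measureReal_nonneg]; exact measureReal_le_one)
    (distFun μ x) hn
  rw [integral_measureReal_le hT] at h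
  have hsq : ∫ y, (poissonPi m x).real {k | y ≤ grid m k} ^ 2 ∂μ = smoothCdfMin μ m x := by
    -- A squared probability is the probability of the event for two independent copies, and both
    -- points dominate `y` exactly when their minimum does.
    have e : ∀ y : Fin d → ℝ, (poissonPi m x).real {k | y ≤ grid m k} ^ 2
        = ((poissonPi m x).prod (poissonPi m x)).real {p | y ≤ grid m p.1 ⊓ grid m p.2} := by
      intro y
      rw [sq, ← measureReal_prod_prod]
      congr 1
      ext p
      simp
    simp_rw [e]
    exact integral_measureReal_le (K := (Fin d → ℕ) × (Fin d → ℕ)) .of_discrete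
  rw [hsq] at h
  simp only [mse]
  simp_rw [estimator_eq _ _ hm hx]
  exact h

end MseDecomposition

/-! ### Moments of the random grid point and of the minimum of two independent ones. -/

section PoissonPi

variable {d : ℕ} {m : ℝ} {x : Fin d → ℝ}

lemma grid_sub_apply (hm : 0 < m) (hx : x ∈ posOrthant d) (k : Fin d → ℕ) (j : Fin d) :
    (grid m k - x) j = ((k j : ℝ) - (m * x j).toNNReal) / m := by
  rw [Real.coe_toNNReal _ (mul_pos hm (hx j)).le, Pi.sub_apply, grid]
  field_simp

lemma grid_sub_apply_pow (hm : 0 < m) (hx : x ∈ posOrthant d) (p : ℕ) (k : Fin d → ℕ)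
    (j : Fin d) :
    (grid m k - x) j ^ p = ((k j : ℝ) - (m * x j).toNNReal) ^ p / m ^ p := by
  rw [grid_sub_apply hm hx, div_pow]

lemma integrable_grid_sub_pow (hm : 0 < m) (hx : x ∈ posOrthant d) (j : Fin d) (p : ℕ) :
    Integrable (fun k : Fin d → ℕ => (grid m k - x) j ^ p) (poissonPi m x) := by
  simp_rw [grid_sub_apply_pow hm hx]
  exact Integrable.div_const (integrable_comp_eval
    (μ := fun j => poissonMeasure (m * x j).toNNReal) (i := j)
    (f := fun n : ℕ => ((n : ℝ) - (m * x j).toNNReal) ^ p)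
    (integrable_sub_pow_poisson (m * x j).toNNReal p (m * x j).toNNReal)) _

lemma integral_grid_sub_pow (hm : 0 < m) (hx : x ∈ posOrthant d) (j : Fin d) (p : ℕ) :
    ∫ k, (grid m k - x) j ^ p ∂poissonPi m x
      = (∫ n : ℕ, ((n : ℝ) - (m * x j).toNNReal) ^ p ∂poissonMeasure (m * x j).toNNReal)
        / m ^ p := by
  simp_rw [grid_sub_apply_pow hm hx]
  rw [integral_div, poissonPi]
  congr 1
  exact integral_comp_eval (μ := fun j => poissonMeasure (m * x j).toNNReal) (i := j)
    (f := fun n : ℕ => ((n : ℝ) - (m * x j).toNNReal) ^ p) .of_discrete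

lemma integrable_grid_sub (hm : 0 < m) (hx : x ∈ posOrthant d) (j : Fin d) :
    Integrable (fun k : Fin d → ℕ => (grid m k - x) j) (poissonPi m x) := by
  simpa using integrable_grid_sub_pow hm hx j 1

lemma integral_grid_sub (hm : 0 < m) (hx : x ∈ posOrthant d) (j : Fin d) :
    ∫ k, (grid m k - x) j ∂poissonPi m x = 0 := by
  have := integral_grid_sub_pow hm hx j 1
  simpa [-Pi.sub_apply, -Real.coe_toNNReal', integral_poisson_sub] using this

lemma integral_grid_sub_sq (hm : 0 < m) (hx : x ∈ posOrthant d) (j : Fin d) :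
    ∫ k, (grid m k - x) j ^ 2 ∂poissonPi m x = x j / m := by
  rw [integral_grid_sub_pow hm hx, integral_poisson_sub_sq,
    Real.coe_toNNReal _ (mul_pos hm (hx j)).le]
  field_simp

lemma integral_grid_sub_pow_four (hm : 0 < m) (hx : x ∈ posOrthant d) (j : Fin d) :
    ∫ k, (grid m k - x) j ^ 4 ∂poissonPi m x = (m * x j + 3 * (m * x j) ^ 2) / m ^ 4 := by
  rw [integral_grid_sub_pow hm hx, integral_poisson_sub_pow_four,
    Real.coe_toNNReal _ (mul_pos hm (hx j)).le]

lemma indepFun_grid_sub {i j : Fin d} (hij : i ≠ j) :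
    IndepFun (fun k : Fin d → ℕ => (grid m k - x) i) (fun k : Fin d → ℕ => (grid m k - x) j) (poissonPi m x) := by
  have h := iIndepFun_pi (μ := fun j => poissonMeasure (m * x j).toNNReal)
    (X := fun j (n : ℕ) => (n : ℝ) / m - x j) (fun _ => Measurable.of_discrete.aemeasurable)
  exact h.indepFun hij

lemma integrable_grid_sub_mul (hm : 0 < m) (hx : x ∈ posOrthant d) (i j : Fin d) :
    Integrable (fun k : Fin d → ℕ => (grid m k - x) i * (grid m k - x) j) (poissonPi m x) := by
  rcases eq_or_ne i j with rfl | hij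
  · simpa [← sq] using integrable_grid_sub_pow hm hx i 2
  · exact (indepFun_grid_sub hij).integrable_mul (integrable_grid_sub hm hx i)
      (integrable_grid_sub hm hx j)

lemma integral_grid_sub_mul (hm : 0 < m) (hx : x ∈ posOrthant d) (i j : Fin d) :
    ∫ k, (grid m k - x) i * (grid m k - x) j ∂poissonPi m x = if i = j then x i / m else 0 := by
  split_ifs with hij
  · subst hij
    simp_rw [← sq]
    exact integral_grid_sub_sq hm hx i
  · rw [(indepFun_grid_sub hij).integral_fun_mul_eq_mul_integral .of_discrete .of_discrete,
      integral_grid_sub hm hx, zero_mul]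

lemma integrable_taylorOne_grid (F : (Fin d → ℝ) → ℝ) (hm : 0 < m) (hx : x ∈ posOrthant d) :
    Integrable (fun k => taylorOne F x (grid m k - x)) (poissonPi m x) :=
  integrable_finsetSum _ fun j _ => (integrable_grid_sub hm hx j).const_mul _

lemma integral_taylorOne_grid (F : (Fin d → ℝ) → ℝ) (hm : 0 < m) (hx : x ∈ posOrthant d) :
    ∫ k, taylorOne F x (grid m k - x) ∂poissonPi m x = 0 := by
  simp only [taylorOne]
  rw [integral_finsetSum _ fun j _ => (integrable_grid_sub hm hx j).const_mul _]
  refine Finset.sum_eq_zero fun j _ => ?_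
  rw [integral_const_mul, integral_grid_sub hm hx, mul_zero]

lemma integrable_taylorTwo_grid (F : (Fin d → ℝ) → ℝ) (hm : 0 < m) (hx : x ∈ posOrthant d) :
    Integrable (fun k => taylorTwo F x (grid m k - x)) (poissonPi m x) :=
  (integrable_finsetSum _ fun i _ => integrable_finsetSum _ fun j _ =>
    (integrable_grid_sub_mul hm hx i j).const_mul _).const_mul _

lemma integral_taylorTwo_grid (F : (Fin d → ℝ) → ℝ) (hm : 0 < m) (hx : x ∈ posOrthant d) :
    ∫ k, taylorTwo F x (grid m k - x) ∂poissonPi m x = B F x / m := by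
  simp only [taylorTwo]
  rw [integral_const_mul, integral_finsetSum _ fun i _ => integrable_finsetSum _ fun j _ =>
    (integrable_grid_sub_mul hm hx i j).const_mul _, B, mul_div_assoc, Finset.sum_div]
  congr 1
  refine Finset.sum_congr rfl fun i _ => ?_
  rw [integral_finsetSum _ fun j _ => (integrable_grid_sub_mul hm hx i j).const_mul _]
  simp_rw [integral_const_mul, integral_grid_sub_mul hm hx]
  simp
  ring

lemma integrable_sum_grid_sub_pow (hm : 0 < m) (hx : x ∈ posOrthant d) (p : ℕ) :
    Integrable (fun k : Fin d → ℕ => ∑ j, (grid m k - x) j ^ p) (poissonPi m x) :=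
  integrable_finsetSum _ fun j _ => integrable_grid_sub_pow hm hx j p

lemma integral_sum_grid_sub_sq (hm : 0 < m) (hx : x ∈ posOrthant d) :
    ∫ k, ∑ j, (grid m k - x) j ^ 2 ∂poissonPi m x = ∑ j, x j / m := by
  rw [integral_finsetSum _ fun j _ => integrable_grid_sub_pow hm hx j 2]
  exact Finset.sum_congr rfl fun j _ => integral_grid_sub_sq hm hx j

lemma integral_sum_grid_sub_pow_four (hm : 0 < m) (hx : x ∈ posOrthant d) :
    ∫ k, ∑ j, (grid m k - x) j ^ 4 ∂poissonPi m x
      = ∑ j, (m * x j + 3 * (m * x j) ^ 2) / m ^ 4 := by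
  rw [integral_finsetSum _ fun j _ => integrable_grid_sub_pow hm hx j 4]
  exact Finset.sum_congr rfl fun j _ => integral_grid_sub_pow_four hm hx j

/-- Source of the `V` term: the first two summands are centred, so only the absolute difference
contributes to the mean. -/
lemma inf_grid_sub_apply (hm : 0 < m) (p : (Fin d → ℕ) × (Fin d → ℕ)) (j : Fin d) :
    (grid m p.1 ⊓ grid m p.2 - x) j
      = ((grid m p.1 - x) j + (grid m p.2 - x) j - |(p.1 j : ℝ) - p.2 j| / m) / 2 := by
  simp only [Pi.sub_apply, Pi.inf_apply]
  have h : |(p.1 j : ℝ) - p.2 j| / m = |grid m p.1 j - grid m p.2 j| := by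
    rw [grid, grid, ← sub_div, abs_div, abs_of_pos hm]
  rw [h]
  rcases le_total (grid m p.1 j) (grid m p.2 j) with hle | hle
  · rw [inf_eq_left.2 hle, abs_of_nonpos (sub_nonpos.2 hle)]
    ring
  · rw [inf_eq_right.2 hle, abs_of_nonneg (sub_nonneg.2 hle)]
    ring

lemma measurePreserving_eval_prod (j : Fin d) :
    MeasurePreserving (fun p : (Fin d → ℕ) × (Fin d → ℕ) => (p.1 j, p.2 j))
      ((poissonPi m x).prod (poissonPi m x))
      ((poissonMeasure (m * x j).toNNReal).prod (poissonMeasure (m * x j).toNNReal)) :=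
  (measurePreserving_eval (fun j => poissonMeasure (m * x j).toNNReal) j).prod
    (measurePreserving_eval (fun j => poissonMeasure (m * x j).toNNReal) j)

lemma integrable_abs_sub_poissonPi (j : Fin d) :
    Integrable (fun p : (Fin d → ℕ) × (Fin d → ℕ) => |(p.1 j : ℝ) - p.2 j|)
      ((poissonPi m x).prod (poissonPi m x)) := by
  have hi : Integrable (fun q : ℕ × ℕ => |(q.1 : ℝ) - q.2|)
      ((poissonMeasure (m * x j).toNNReal).prod (poissonMeasure (m * x j).toNNReal)) :=
    (((integrable_natCast_poisson _).comp_fst _).sub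
      ((integrable_natCast_poisson _).comp_snd _)).abs
  exact (measurePreserving_eval_prod j).integrable_comp_of_integrable hi

lemma integral_abs_sub_poissonPi (j : Fin d) :
    ∫ p : (Fin d → ℕ) × (Fin d → ℕ), |(p.1 j : ℝ) - p.2 j| ∂(poissonPi m x).prod (poissonPi m x)
      = poissonAbsDiff (m * x j).toNNReal := by
  rw [poissonAbsDiff, ← (measurePreserving_eval_prod j).map_eq,
    integral_map (measurePreserving_eval_prod (m := m) (x := x) j).measurable.aemeasurable .of_discrete]

lemma integrable_inf_grid_sub (hm : 0 < m) (hx : x ∈ posOrthant d) (j : Fin d) :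
    Integrable (fun p : (Fin d → ℕ) × (Fin d → ℕ) => (grid m p.1 ⊓ grid m p.2 - x) j)
      ((poissonPi m x).prod (poissonPi m x)) := by
  simp_rw [inf_grid_sub_apply hm]
  exact ((((integrable_grid_sub hm hx j).comp_fst _).add
    ((integrable_grid_sub hm hx j).comp_snd _)).sub
      ((integrable_abs_sub_poissonPi j).div_const m)).div_const 2

lemma integral_inf_grid_sub (hm : 0 < m) (hx : x ∈ posOrthant d) (j : Fin d) :
    ∫ p : (Fin d → ℕ) × (Fin d → ℕ), (grid m p.1 ⊓ grid m p.2 - x) j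
        ∂(poissonPi m x).prod (poissonPi m x)
      = -(poissonAbsDiff (m * x j).toNNReal / (2 * m)) := by
  have i1 := (integrable_grid_sub hm hx j).comp_fst (poissonPi m x)
  have i2 := (integrable_grid_sub hm hx j).comp_snd (poissonPi m x)
  have i3 := (integrable_abs_sub_poissonPi (m := m) (x := x) j).div_const m
  have z1 : ∫ p : (Fin d → ℕ) × (Fin d → ℕ), (grid m p.1 - x) j
      ∂(poissonPi m x).prod (poissonPi m x) = 0 := by
    rw [integral_fun_fst (fun k : Fin d → ℕ => (grid m k - x) j), integral_grid_sub hm hx, smul_zero]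
  have z2 : ∫ p : (Fin d → ℕ) × (Fin d → ℕ), (grid m p.2 - x) j
      ∂(poissonPi m x).prod (poissonPi m x) = 0 := by
    rw [integral_fun_snd (fun k : Fin d → ℕ => (grid m k - x) j), integral_grid_sub hm hx, smul_zero]
  simp_rw [inf_grid_sub_apply hm]
  have i12 : Integrable (fun p : (Fin d → ℕ) × (Fin d → ℕ) =>
      (grid m p.1 - x) j + (grid m p.2 - x) j) ((poissonPi m x).prod (poissonPi m x)) := i1.add i2
  rw [integral_div, integral_sub i12 i3, integral_add i1 i2, z1, z2, integral_div,
    integral_abs_sub_poissonPi]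
  field_simp
  ring

lemma integrable_taylorOne_inf_grid (F : (Fin d → ℝ) → ℝ) (hm : 0 < m)
    (hx : x ∈ posOrthant d) :
    Integrable (fun p : (Fin d → ℕ) × (Fin d → ℕ) => taylorOne F x (grid m p.1 ⊓ grid m p.2 - x))
      ((poissonPi m x).prod (poissonPi m x)) :=
  integrable_finsetSum _ fun j _ => (integrable_inf_grid_sub hm hx j).const_mul _

lemma integral_taylorOne_inf_grid (F : (Fin d → ℝ) → ℝ) (hm : 0 < m) (hx : x ∈ posOrthant d) :
    ∫ p : (Fin d → ℕ) × (Fin d → ℕ), taylorOne F x (grid m p.1 ⊓ grid m p.2 - x)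
        ∂(poissonPi m x).prod (poissonPi m x)
      = -∑ j, partialDeriv j F x * (poissonAbsDiff (m * x j).toNNReal / (2 * m)) := by
  simp only [taylorOne]
  rw [integral_finsetSum _ fun j _ => (integrable_inf_grid_sub hm hx j).const_mul _,
    ← Finset.sum_neg_distrib]
  refine Finset.sum_congr rfl fun j _ => ?_
  rw [integral_const_mul, integral_inf_grid_sub hm hx, mul_neg]

/-- Each coordinate of the minimum is a coordinate of one of the two points. -/
lemma sum_inf_grid_sub_sq_le (p : (Fin d → ℕ) × (Fin d → ℕ)) :
    ∑ j, (grid m p.1 ⊓ grid m p.2 - x) j ^ 2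
      ≤ ∑ j, (grid m p.1 - x) j ^ 2 + ∑ j, (grid m p.2 - x) j ^ 2 := by
  rw [← Finset.sum_add_distrib]
  refine Finset.sum_le_sum fun j _ => ?_
  simp only [Pi.sub_apply, Pi.inf_apply]
  rcases le_total (grid m p.1 j) (grid m p.2 j) with hle | hle
  · rw [inf_eq_left.2 hle]
    exact le_add_of_nonneg_right (sq_nonneg _)
  · rw [inf_eq_right.2 hle]
    exact le_add_of_nonneg_left (sq_nonneg _)

end PoissonPi

/-! ### Bias and second moment at a fixed level, with explicit error bounds. -/

section Expansion

variable {d : ℕ} {μ : Measure (Fin d → ℝ)} [IsProbabilityMeasure μ]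

lemma abs_distFun_sub_le (x y : Fin d → ℝ) : |distFun μ y - distFun μ x| ≤ 1 := by
  have h1 : distFun μ y ≤ 1 := measureReal_le_one
  have h2 : distFun μ x ≤ 1 := measureReal_le_one
  have h3 : 0 ≤ distFun μ y := measureReal_nonneg
  have h4 : 0 ≤ distFun μ x := measureReal_nonneg
  rw [abs_le]
  constructor <;> linarith

lemma abs_distFun_le (x : Fin d → ℝ) : |distFun μ x| ≤ 1 := by
  rw [distFun, abs_of_nonneg measureReal_nonneg]
  exact measureReal_le_one

/-- Quantitative Voronovskaya estimate for the Szász–Mirakyan smoothing. -/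
lemma abs_smoothCdf_sub_le {m : ℝ} (hm : 0 < m) {x : Fin d → ℝ} (hx : x ∈ posOrthant d)
    {ε C : ℝ} (h : ∀ u, |distFun μ (x + u) - distFun μ x - taylorOne (distFun μ) x u
      - taylorTwo (distFun μ) x u| ≤ ε * ∑ j, u j ^ 2 + C * ∑ j, u j ^ 4) :
    |smoothCdf μ m x - distFun μ x - B (distFun μ) x / m|
      ≤ ε * ∑ j, x j / m + C * ∑ j, (m * x j + 3 * (m * x j) ^ 2) / m ^ 4 := by
  have iF : Integrable (fun k => distFun μ (grid m k)) (poissonPi m x) :=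
    Integrable.of_bound (C := 1) .of_discrete (Eventually.of_forall fun k => abs_distFun_le _)
  have iF' : Integrable (fun k => distFun μ (grid m k) - distFun μ x) (poissonPi m x) :=
    iF.sub (integrable_const _)
  have iT := integrable_taylorOne_grid (distFun μ) hm hx
  have iT2 := integrable_taylorTwo_grid (distFun μ) hm hx
  have iFT : Integrable (fun k => distFun μ (grid m k) - distFun μ x
      - taylorOne (distFun μ) x (grid m k - x)) (poissonPi m x) := iF'.sub iT
  have e : smoothCdf μ m x - distFun μ x - B (distFun μ) x / m
      = ∫ k, (distFun μ (grid m k) - distFun μ x - taylorOne (distFun μ) x (grid m k - x)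
        - taylorTwo (distFun μ) x (grid m k - x)) ∂poissonPi m x := by
    rw [integral_sub iFT iT2, integral_sub iF' iT, integral_sub iF (integrable_const _),
      integral_taylorOne_grid _ hm hx, integral_taylorTwo_grid _ hm hx]
    simp [smoothCdf]
  have i2 := (integrable_sum_grid_sub_pow hm hx 2).const_mul ε
  have i4 := (integrable_sum_grid_sub_pow hm hx 4).const_mul C
  rw [e, ← Real.norm_eq_abs]
  refine (norm_integral_le_of_norm_le (i2.add i4) (Eventually.of_forall fun k => ?_)).trans_eq ?_
  · have := h (grid m k - x)
    rw [add_sub_cancel] at this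
    exact this
  · simp only [Pi.add_apply]
    rw [integral_add i2 i4, integral_const_mul, integral_const_mul,
      integral_sum_grid_sub_sq hm hx, integral_sum_grid_sub_pow_four hm hx]

/-- First order is enough: the linear term does not average out and has order `m^{-1/2}`, while the
quadratic remainder is `O(1/m)`. -/
lemma abs_smoothCdfMin_sub_le {m : ℝ} (hm : 0 < m) {x : Fin d → ℝ} (hx : x ∈ posOrthant d)
    {C : ℝ} (hC : 0 ≤ C) (h : ∀ u, |distFun μ (x + u) - distFun μ x
      - taylorOne (distFun μ) x u| ≤ C * ∑ j, u j ^ 2) :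
    |smoothCdfMin μ m x - distFun μ x
        + ∑ j, partialDeriv j (distFun μ) x * (poissonAbsDiff (m * x j).toNNReal / (2 * m))|
      ≤ C * (∑ j, x j / m + ∑ j, x j / m) := by
  set ρ := (poissonPi m x).prod (poissonPi m x) with hρ
  have iF : Integrable (fun p : (Fin d → ℕ) × (Fin d → ℕ) =>
      distFun μ (grid m p.1 ⊓ grid m p.2)) ρ :=
    Integrable.of_bound (C := 1) .of_discrete (Eventually.of_forall fun k => abs_distFun_le _)
  have iF' : Integrable (fun p : (Fin d → ℕ) × (Fin d → ℕ) =>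
      distFun μ (grid m p.1 ⊓ grid m p.2) - distFun μ x) ρ :=
    iF.sub (integrable_const _)
  have iT := integrable_taylorOne_inf_grid (distFun μ) hm hx
  have e : smoothCdfMin μ m x - distFun μ x
        + ∑ j, partialDeriv j (distFun μ) x * (poissonAbsDiff (m * x j).toNNReal / (2 * m))
      = ∫ p, (distFun μ (grid m p.1 ⊓ grid m p.2) - distFun μ x
        - taylorOne (distFun μ) x (grid m p.1 ⊓ grid m p.2 - x)) ∂ρ := by
    rw [integral_sub iF' iT, integral_sub iF (integrable_const _),
      integral_taylorOne_inf_grid _ hm hx]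
    simp [smoothCdfMin, hρ]
  have i1 := (integrable_sum_grid_sub_pow hm hx 2).comp_fst (poissonPi m x)
  have i2 := (integrable_sum_grid_sub_pow hm hx 2).comp_snd (poissonPi m x)
  rw [e, ← Real.norm_eq_abs]
  refine (norm_integral_le_of_norm_le ((i1.add i2).const_mul C)
    (Eventually.of_forall fun p => ?_)).trans_eq ?_
  · have := h (grid m p.1 ⊓ grid m p.2 - x)
    rw [add_sub_cancel] at this
    exact this.trans (mul_le_mul_of_nonneg_left (sum_inf_grid_sub_sq_le p) hC)
  · rw [integral_const_mul]
    simp only [Pi.add_apply]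
    rw [integral_add i1 i2, integral_fun_fst (fun k : Fin d → ℕ => ∑ j, (grid m k - x) j ^ 2),
      integral_fun_snd (fun k : Fin d → ℕ => ∑ j, (grid m k - x) j ^ 2), integral_sum_grid_sub_sq hm hx]
    simp

end Expansion

/-! ### Asymptotics uniform on compact sets, and the expansion of the MSE. -/

section Uniform

variable {d : ℕ} {S : Set (Fin d → ℝ)}

lemma exists_coord_le (hS : IsCompact S) : ∃ A, 0 ≤ A ∧ ∀ x ∈ S, ∀ j, x j ≤ A := by
  obtain ⟨A, hA⟩ := hS.isBounded.exists_norm_le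
  refine ⟨max A 0, le_max_right _ _, fun x hx j => ?_⟩
  exact (le_abs_self _).trans ((norm_le_pi_norm x j).trans ((hA x hx).trans (le_max_left _ _)))

lemma exists_le_coord (hS : IsCompact S) (hSp : S ⊆ posOrthant d) (j : Fin d) :
    ∃ a, 0 < a ∧ ∀ x ∈ S, a ≤ x j :=
  hS.exists_forall_le' (continuous_apply j).continuousOn fun _ hx => hSp hx j

variable {μ : Measure (Fin d → ℝ)} [IsProbabilityMeasure μ]

/-- Uniform asymptotics of the bias. -/
lemma eventually_smoothCdf (hF : InteriorC2 (distFun μ)) (hS : IsCompact S)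
    (hSp : S ⊆ posOrthant d) {ε : ℝ} (hε : 0 < ε) :
    ∀ᶠ m : ℝ in atTop, ∀ x ∈ S,
      |smoothCdf μ m x - distFun μ x - B (distFun μ) x / m| ≤ ε / m := by
  obtain ⟨A, hA, hSA⟩ := exists_coord_le hS
  -- As `∑ x_j ≤ d A` on `S`, the variance part of the remainder is at most `ε/(2m)`; the `+ 1`
  -- keeps the denominator positive. The second threshold on `m` below does the same for the fourth
  -- moments.
  obtain ⟨C, hC, hT⟩ := hF.taylor_two abs_distFun_sub_le hS hSp
    (ε := ε / (2 * (d * A + 1))) (by positivity)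
  filter_upwards [eventually_ge_atTop 1,
    eventually_ge_atTop (2 * (C * (d * (A + 3 * A ^ 2))) / ε)] with m hm1 hm2 x hx
  have hm : 0 < m := by linarith
  have hxp := hSp hx
  refine (abs_smoothCdf_sub_le hm hxp (hT x hx)).trans ?_
  have s1 : ∑ j, x j / m ≤ d * A / m := by
    rw [← Finset.sum_div]
    gcongr
    calc ∑ j, x j ≤ ∑ _j : Fin d, A := Finset.sum_le_sum fun j _ => hSA x hx j
      _ = d * A := by simp
  have s2 : ∑ j, (m * x j + 3 * (m * x j) ^ 2) / m ^ 4 ≤ d * (A + 3 * A ^ 2) / m ^ 2 := by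
    calc ∑ j, (m * x j + 3 * (m * x j) ^ 2) / m ^ 4
        ≤ ∑ _j : Fin d, (A + 3 * A ^ 2) / m ^ 2 := Finset.sum_le_sum fun j _ => by
          have hj := hSA x hx j
          have hj0 := (hxp j).le
          have h1 : m * x j + 3 * (m * x j) ^ 2 ≤ m ^ 2 * (A + 3 * A ^ 2) := by
            have h2 : m * x j ≤ m ^ 2 * A := by
              calc m * x j ≤ m * A := by gcongr
                _ ≤ m ^ 2 * A := by gcongr; nlinarith
            have h3 : (m * x j) ^ 2 ≤ m ^ 2 * A ^ 2 := by
              rw [mul_pow]; gcongr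
            linarith
          calc _ ≤ m ^ 2 * (A + 3 * A ^ 2) / m ^ 4 := by gcongr
            _ = _ := by field_simp
      _ = _ := by simp; ring
  have t1 : ε / (2 * (d * A + 1)) * ∑ j, x j / m ≤ ε / 2 / m := by
    calc _ ≤ ε / (2 * (d * A + 1)) * (d * A / m) := by gcongr
      _ ≤ ε / (2 * (d * A + 1)) * ((d * A + 1) / m) := by gcongr; linarith
      _ = _ := by field_simp
  have t2 : C * ∑ j, (m * x j + 3 * (m * x j) ^ 2) / m ^ 4 ≤ ε / 2 / m := by
    calc _ ≤ C * (d * (A + 3 * A ^ 2) / m ^ 2) := by gcongr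
      _ = (C * (d * (A + 3 * A ^ 2))) / m / m := by field_simp
      _ ≤ _ := by
        refine div_le_div_of_nonneg_right ?_ hm.le
        rw [div_le_iff₀ hε] at hm2
        rw [div_le_iff₀ hm]
        linarith
  calc _ ≤ ε / 2 / m + ε / 2 / m := add_le_add t1 t2
    _ = ε / m := by ring

/-- On `S` the coordinate `x_j` is bounded below by some `a > 0`, so the Poisson mean `m x_j ≥ m a`
tends to infinity uniformly and a one-variable limit suffices. -/
lemma eventually_poissonAbsDiff (hS : IsCompact S) (hSp : S ⊆ posOrthant d) {η : ℝ}
    (hη : 0 < η) :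
    ∀ᶠ m : ℝ in atTop, ∀ j, ∀ x ∈ S,
      |poissonAbsDiff (m * x j).toNNReal / (2 * m) - √(x j / Real.pi) / √m|
        ≤ η * √(x j) / √m := by
  rw [eventually_all]
  intro j
  obtain ⟨a, ha, hSa⟩ := exists_le_coord hS hSp j
  have h1 := Metric.tendsto_nhds.1 tendsto_poissonAbsDiff_div_sqrt (2 * η) (by positivity)
  obtain ⟨Λ, hΛ⟩ := eventually_atTop.1 h1
  filter_upwards [eventually_gt_atTop 0, eventually_ge_atTop (Λ / a)] with m hm hmΛ x hx
  have hxj : 0 < x j := hSp hx j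
  have hΛ' : Λ ≤ m * x j := by
    rw [div_le_iff₀ ha] at hmΛ
    exact hmΛ.trans (by gcongr; exact hSa x hx)
  have h2 := (hΛ _ hΛ').le
  rw [Real.dist_eq] at h2
  set q := poissonAbsDiff (m * x j).toNNReal
  have hsm : 0 < √m := Real.sqrt_pos.2 hm
  have hsx : 0 < √(x j) := Real.sqrt_pos.2 hxj
  have hsp : 0 < √Real.pi := Real.sqrt_pos.2 Real.pi_pos
  have hmm : √m * √m = m := Real.mul_self_sqrt hm.le
  rw [Real.sqrt_mul hm.le] at h2
  rw [Real.sqrt_div hxj.le]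
  have e : q / (2 * m) - √(x j) / √Real.pi / √m
      = (√(x j) / (2 * √m)) * (q / (√m * √(x j)) - 2 / √Real.pi) := by
    nth_rewrite 1 [← hmm]
    field_simp
  rw [e, abs_mul, abs_of_pos (by positivity : 0 < √(x j) / (2 * √m))]
  calc _ ≤ √(x j) / (2 * √m) * (2 * η) := by gcongr
    _ = _ := by field_simp

/-- Uniform asymptotics of the second moment of the smoothed indicator. -/
lemma eventually_smoothCdfMin (hF : InteriorC2 (distFun μ)) (hS : IsCompact S)
    (hSp : S ⊆ posOrthant d) {ε : ℝ} (hε : 0 < ε) :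
    ∀ᶠ m : ℝ in atTop, ∀ x ∈ S,
      |smoothCdfMin μ m x - distFun μ x + V (distFun μ) x / √m| ≤ ε / √m := by
  obtain ⟨A, hA, hSA⟩ := exists_coord_le hS
  obtain ⟨C, hC, hT⟩ := hF.taylor_one abs_distFun_sub_le hS hSp
  obtain ⟨M, hM0, hM⟩ := hF.partialDeriv_bound hS hSp
  -- Brings the Taylor remainder, at most `2CdA/m`, below `ε/(2√m)`.
  have hsq : ∀ᶠ m : ℝ in atTop, 4 * (C * (d * A)) / ε ≤ √m :=
    Real.tendsto_sqrt_atTop.eventually_ge_atTop _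
  have hK : 0 < ε / (2 * (d * (M * √A) + 1)) := by positivity
  filter_upwards [eventually_gt_atTop 0, hsq, eventually_poissonAbsDiff hS hSp hK]
    with m hm hm2 hP x hx
  have hxp := hSp hx
  have hsm : 0 < √m := Real.sqrt_pos.2 hm
  have hmm : √m * √m = m := Real.mul_self_sqrt hm.le
  have h1 := abs_smoothCdfMin_sub_le hm hxp hC (hT x hx)
  set η := ε / (2 * (d * (M * √A) + 1)) with hη
  set T := ∑ j, partialDeriv j (distFun μ) x * (poissonAbsDiff (m * x j).toNNReal / (2 * m))
  have h2 : |T - V (distFun μ) x / √m| ≤ ε / 2 / √m := by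
    rw [V, Finset.sum_div, ← Finset.sum_sub_distrib]
    calc _ ≤ ∑ _j : Fin d, M * (η * √A / √m) := by
          refine (Finset.abs_sum_le_sum_abs _ _).trans (Finset.sum_le_sum fun j _ => ?_)
          rw [mul_div_assoc, ← mul_sub, abs_mul]
          refine mul_le_mul ((hM x hx).1 j) ((hP j x hx).trans ?_) (abs_nonneg _) hM0
          gcongr
          exact hSA x hx j
      _ = η * (d * (M * √A)) / √m := by simp; ring
      _ ≤ η * (d * (M * √A) + 1) / √m := by gcongr; linarith
      _ = _ := by rw [hη]; field_simp
  have s1 : ∑ j, x j / m ≤ d * A / m := by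
    rw [← Finset.sum_div]
    gcongr
    calc ∑ j, x j ≤ ∑ _j : Fin d, A := Finset.sum_le_sum fun j _ => hSA x hx j
      _ = d * A := by simp
  have h3 : C * (∑ j, x j / m + ∑ j, x j / m) ≤ ε / 2 / √m := by
    calc _ ≤ C * (d * A / m + d * A / m) := by gcongr
      _ = 2 * (C * (d * A)) / √m / √m := by rw [div_div _ √m, hmm]; ring
      _ ≤ _ := by
        refine div_le_div_of_nonneg_right ?_ hsm.le
        rw [div_le_iff₀ hε] at hm2
        rw [div_le_iff₀ hsm]
        linarith
  have e : smoothCdfMin μ m x - distFun μ x + V (distFun μ) x / √m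
      = (smoothCdfMin μ m x - distFun μ x + T) - (T - V (distFun μ) x / √m) := by ring
  rw [e]
  calc _ ≤ |smoothCdfMin μ m x - distFun μ x + T| + |T - V (distFun μ) x / √m| := abs_sub _ _
    _ ≤ ε / 2 / √m + ε / 2 / √m := add_le_add (h1.trans h3) h2
    _ = ε / √m := by ring

lemma InteriorC2.exists_B_le {F : (Fin d → ℝ) → ℝ} (hF : InteriorC2 F) (hS : IsCompact S)
    (hSp : S ⊆ posOrthant d) : ∃ b, 0 ≤ b ∧ ∀ x ∈ S, |B F x| ≤ b := by
  obtain ⟨A, hA, hSA⟩ := exists_coord_le hS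
  obtain ⟨M, hM0, hM⟩ := hF.partialDeriv_bound hS hSp
  refine ⟨1 / 2 * ∑ _j : Fin d, A * M, by positivity, fun x hx => ?_⟩
  rw [B, abs_mul, abs_of_pos (by norm_num : (0 : ℝ) < 1 / 2)]
  gcongr
  refine (Finset.abs_sum_le_sum_abs _ _).trans (Finset.sum_le_sum fun j _ => ?_)
  rw [abs_mul, abs_of_pos (hSp hx j)]
  exact mul_le_mul (hSA x hx j) ((hM x hx).2 j j) (abs_nonneg _) hA

lemma abs_smoothCdf_le (m : ℝ) (x : Fin d → ℝ) : |smoothCdf μ m x| ≤ 1 := by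
  have := norm_integral_le_of_norm_le_const (μ := poissonPi m x)
    (f := fun k => distFun μ (grid m k)) (C := 1) (Eventually.of_forall fun k => abs_distFun_le _)
  simpa [smoothCdf] using this

lemma rpow_neg_half_eq {m : ℝ} (hm : 0 < m) : m ^ (-(1 / 2) : ℝ) = (√m)⁻¹ := by
  rw [Real.rpow_neg hm.le, Real.sqrt_eq_rpow]

lemma rpow_neg_two_eq {m : ℝ} (hm : 0 < m) : m ^ (-2 : ℝ) = (m ^ 2)⁻¹ := by
  rw [Real.rpow_neg hm.le, Real.rpow_two]

/-- Uniform expansion of the mean squared error on compact subsets of the open orthant. -/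
theorem eventually_mse {Ω : Type*} [MeasurableSpace Ω] {P : Measure Ω} [IsProbabilityMeasure P]
    {X : ℕ → Ω → Fin d → ℝ} (hlaw : ∀ i, HasLaw (X i) μ P) (hindep : iIndepFun X P)
    (hF : InteriorC2 (distFun μ)) (hS : IsCompact S) (hSp : S ⊆ posOrthant d) {ε : ℝ}
    (hε : 0 < ε) :
    ∀ᶠ p : ℕ × ℝ in atTop ×ˢ atTop, ∀ x ∈ S,
      |mse P X (distFun μ) x p.1 p.2 - leadingMse (distFun μ) x p.1 p.2|
        ≤ ε * ((p.1 : ℝ)⁻¹ * p.2 ^ (-(1 / 2) : ℝ)) + ε * p.2 ^ (-2 : ℝ) := by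
  obtain ⟨b, hb, hB⟩ := hF.exists_B_le hS hSp
  -- The squared bias differs from `(B/m)²` by at most `(η/m)((b+1)/m + b/m) = η(2b+1)/m²`.
  set η := min 1 (ε / (2 * b + 1)) with hηdef
  have hη : 0 < η := lt_min one_pos (by positivity)
  have hη1 : η ≤ 1 := min_le_left _ _
  have hηε : η * (2 * b + 1) ≤ ε := by
    rw [← le_div_iff₀ (by positivity)]
    exact min_le_right _ _
  have hsq : ∀ᶠ m : ℝ in atTop, 4 * (b + 1) / ε ≤ √m :=
    Real.tendsto_sqrt_atTop.eventually_ge_atTop _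
  have hm : ∀ᶠ m : ℝ in atTop, 0 < m ∧ 4 * (b + 1) / ε ≤ √m ∧
      (∀ x ∈ S, |smoothCdf μ m x - distFun μ x - B (distFun μ) x / m| ≤ η / m) ∧
      (∀ x ∈ S, |smoothCdfMin μ m x - distFun μ x + V (distFun μ) x / √m| ≤ ε / 2 / √m) := by
    filter_upwards [eventually_gt_atTop 0, hsq, eventually_smoothCdf hF hS hSp hη,
      eventually_smoothCdfMin hF hS hSp (half_pos hε)] with m h1 h2 h3 h4
    exact ⟨h1, h2, h3, h4⟩
  filter_upwards [(eventually_ne_atTop (0 : ℕ)).prod_mk hm]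
  rintro ⟨n, m⟩ ⟨hn, hm, hm2, hG, hQ⟩ x hx
  simp only at hn hm hm2 hG hQ ⊢
  have hsm : 0 < √m := Real.sqrt_pos.2 hm
  have hmm : √m * √m = m := Real.mul_self_sqrt hm.le
  have hn0 : 0 < (n : ℝ) := by exact_mod_cast Nat.pos_of_ne_zero hn
  rw [mse_eq hlaw hindep hn hm (hSp hx), leadingMse, sigmaSq, rpow_neg_half_eq hm,
    rpow_neg_two_eq hm]
  specialize hG x hx
  specialize hQ x hx
  have hBx := hB x hx
  have hG1 := abs_smoothCdf_le (μ := μ) m x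
  have hF1 := abs_distFun_le (μ := μ) x
  set G := smoothCdf μ m x
  set Q := smoothCdfMin μ m x
  set Fx := distFun μ x
  set Bx := B (distFun μ) x
  set Vx := V (distFun μ) x
  have hBm : |Bx / m| ≤ b / m := by rw [abs_div, abs_of_pos hm]; gcongr
  have hD : |G - Fx| ≤ (b + 1) / m := by
    have e : G - Fx = (G - Fx - Bx / m) + Bx / m := by ring
    rw [e]
    calc _ ≤ η / m + b / m := (abs_add_le _ _).trans (add_le_add hG hBm)
      _ ≤ 1 / m + b / m := by gcongr
      _ = _ := by ring
  -- In the variance the smoothed mean may be replaced by `F`: the cost `O(1/m)` is negligible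
  -- against `m^{-1/2}`.
  have k1 : |G ^ 2 - Fx ^ 2| ≤ ε / 2 / √m := by
    have e : G ^ 2 - Fx ^ 2 = (G - Fx) * (G + Fx) := by ring
    rw [e, abs_mul]
    calc _ ≤ (b + 1) / m * 2 := by
          gcongr
          exact (abs_add_le _ _).trans (by linarith)
      _ = 2 * (b + 1) / √m / √m := by rw [div_div _ √m, hmm]; ring
      _ ≤ _ := by
        refine div_le_div_of_nonneg_right ?_ hsm.le
        rw [div_le_iff₀ hε] at hm2
        rw [div_le_iff₀ hsm]
        linarith
  have k2 : |(G - Fx) ^ 2 - (Bx / m) ^ 2| ≤ ε * (m ^ 2)⁻¹ := by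
    have e : (G - Fx) ^ 2 - (Bx / m) ^ 2
        = (G - Fx - Bx / m) * ((G - Fx) + Bx / m) := by ring
    rw [e, abs_mul]
    calc _ ≤ η / m * ((b + 1) / m + b / m) := by
          gcongr
          exact (abs_add_le _ _).trans (add_le_add hD hBm)
      _ = η * (2 * b + 1) * (m ^ 2)⁻¹ := by field_simp; ring
      _ ≤ _ := by gcongr
  have e : (n : ℝ)⁻¹ * (Q - G ^ 2) + (G - Fx) ^ 2
        - ((n : ℝ)⁻¹ * (Fx * (1 - Fx)) - (n : ℝ)⁻¹ * (√m)⁻¹ * Vx + (m ^ 2)⁻¹ * Bx ^ 2)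
      = (n : ℝ)⁻¹ * ((Q - Fx + Vx / √m) - (G ^ 2 - Fx ^ 2))
        + ((G - Fx) ^ 2 - (Bx / m) ^ 2) := by
    field_simp
    ring
  rw [e]
  calc _ ≤ (n : ℝ)⁻¹ * (ε / 2 / √m + ε / 2 / √m) + ε * (m ^ 2)⁻¹ := by
        refine (abs_add_le _ _).trans (add_le_add ?_ k2)
        rw [abs_mul, abs_of_pos (inv_pos.2 hn0)]
        gcongr
        exact (abs_sub _ _).trans (add_le_add hQ k1)
    _ = _ := by field_simp; ring

end Uniform

/-! ### Minimization of the leading part and asymptotic optimality. -/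

section Optimal

variable {d : ℕ}

/-- A distribution function is monotone along each coordinate line. No differentiability is needed,
the derivative being `0` by default where it does not exist. -/
lemma partialDeriv_distFun_nonneg (μ : Measure (Fin d → ℝ)) [IsProbabilityMeasure μ]
    (j : Fin d) (x : Fin d → ℝ) : 0 ≤ partialDeriv j (distFun μ) x := by
  rw [partialDeriv, lineDeriv]
  refine Monotone.deriv_nonneg fun s t hst => ?_
  refine measureReal_mono (Set.Iic_subset_Iic.2 ?_)
  gcongr
  exact Pi.single_nonneg.2 zero_le_one

lemma V_distFun_nonneg (μ : Measure (Fin d → ℝ)) [IsProbabilityMeasure μ] (x : Fin d → ℝ) :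
    0 ≤ V (distFun μ) x :=
  Finset.sum_nonneg fun j _ => mul_nonneg (partialDeriv_distFun_nonneg μ j x) (Real.sqrt_nonneg _)

variable {F : (Fin d → ℝ) → ℝ} {x : Fin d → ℝ}

/-- The excess of the normalized leading risk over its minimum, as a function of
`t = (m / m_opt)^{-1/2}`. -/
noncomputable def excess (t : ℝ) : ℝ := t ^ 4 / 4 - t + 3 / 4

/-- The difference of the two sides is `(t² - 1)²/2`. Thus `t = 1` is the only minimizer, and
`excess → 0` forces `t → 1`. -/
lemma sq_le_excess (t : ℝ) : (t - 1) ^ 2 ≤ 2 * excess t := by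
  have : 2 * excess t - (t - 1) ^ 2 = (t - 1) ^ 2 * ((t + 1) ^ 2) / 2 := by
    rw [excess]; ring
  nlinarith [mul_nonneg (sq_nonneg (t - 1)) (sq_nonneg (t + 1))]

lemma excess_nonneg (t : ℝ) : 0 ≤ excess t := by
  nlinarith [sq_le_excess t, sq_nonneg (t - 1)]

/-- The error terms of the MSE are multiples of `t` and `t⁴`; this controls them at every level,
also for competitors far from `mOpt`. -/
lemma add_pow_four_le_excess (t : ℝ) : t + t ^ 4 ≤ 9 * (1 + excess t) := by
  have h : t ≤ t ^ 4 / 8 + 1 := by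
    nlinarith [sq_nonneg (t ^ 2 - 2), sq_nonneg (t - 1)]
  rw [excess]
  linarith

/-- The relative level `(m / m_opt)^{-1/2}`. -/
noncomputable def relLevel (F : (Fin d → ℝ) → ℝ) (x : Fin d → ℝ) (n : ℕ) (m : ℝ) : ℝ :=
  (m / mOpt F x n) ^ (-(1 / 2) : ℝ)

/-- The constant `[V⁴ / (4 B²)]^{1/3}`. -/
noncomputable def gainConst (F : (Fin d → ℝ) → ℝ) (x : Fin d → ℝ) : ℝ :=
  (V F x ^ 4 / (4 * B F x ^ 2)) ^ (1 / 3 : ℝ)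

lemma mOpt_pos (hV : 0 < V F x) (hB : B F x ≠ 0) {n : ℕ} (hn : n ≠ 0) : 0 < mOpt F x n := by
  have : 0 < (n : ℝ) := by exact_mod_cast Nat.pos_of_ne_zero hn
  have : 0 < B F x ^ 2 := by positivity
  unfold mOpt
  positivity

lemma gainConst_pos (hV : 0 < V F x) (hB : B F x ≠ 0) : 0 < gainConst F x := by
  have : 0 < B F x ^ 2 := by positivity
  unfold gainConst
  positivity

lemma relLevel_pos (hV : 0 < V F x) (hB : B F x ≠ 0) {n : ℕ} (hn : n ≠ 0) {m : ℝ}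
    (hm : 0 < m) : 0 < relLevel F x n m :=
  Real.rpow_pos_of_pos (div_pos hm (mOpt_pos hV hB hn)) _

lemma relLevel_mOpt (hV : 0 < V F x) (hB : B F x ≠ 0) {n : ℕ} (hn : n ≠ 0) :
    relLevel F x n (mOpt F x n) = 1 := by
  rw [relLevel, div_self (mOpt_pos hV hB hn).ne', Real.one_rpow]

lemma relLevel_rpow (hV : 0 < V F x) (hB : B F x ≠ 0) {n : ℕ} (hn : n ≠ 0) {m : ℝ}
    (hm : 0 < m) : relLevel F x n m ^ (-2 : ℝ) = m / mOpt F x n := by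
  rw [relLevel, ← Real.rpow_mul (div_pos hm (mOpt_pos hV hB hn)).le]
  norm_num

/-- `n⁻¹ m_opt^{-1/2} = n^{-4/3} [V⁴ / (4 B²)]^{1/3} / V`. -/
lemma inv_mul_mOpt_rpow (hV : 0 < V F x) (hB : B F x ≠ 0) {n : ℕ} (hn : n ≠ 0) :
    (n : ℝ)⁻¹ * mOpt F x n ^ (-(1 / 2) : ℝ)
      = (n : ℝ) ^ (-(4 / 3) : ℝ) * (gainConst F x / V F x) := by
  have hn0 : 0 < (n : ℝ) := by exact_mod_cast Nat.pos_of_ne_zero hn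
  have hB2 : 0 < B F x ^ 2 := by positivity
  rw [mOpt, gainConst, Real.mul_rpow (by positivity) (by positivity),
    ← Real.rpow_mul hn0.le, ← Real.rpow_mul (by positivity), ← Real.rpow_neg_one (n : ℝ),
    ← mul_assoc, ← Real.rpow_add hn0]
  norm_num only
  congr 1
  have e : V F x ^ 4 / (4 * B F x ^ 2) = V F x ^ (3 : ℝ) * (4 * B F x ^ 2 / V F x)⁻¹ := by
    rw [Real.rpow_ofNat]
    field_simp
  rw [e, Real.mul_rpow (by positivity) (by positivity), ← Real.rpow_mul hV.le,
    Real.inv_rpow (by positivity), ← Real.rpow_neg (by positivity)]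
  norm_num
  field_simp

/-- With `w = m^{-1/2}` this is the critical-point equation `V/n = 4B²w³` of `-n⁻¹Vw + B²w⁴`. -/
lemma mOpt_rpow_pow_three (hV : 0 < V F x) (hB : B F x ≠ 0) {n : ℕ} (hn : n ≠ 0) :
    (mOpt F x n ^ (-(1 / 2) : ℝ)) ^ 3 = (n : ℝ)⁻¹ * (V F x / (4 * B F x ^ 2)) := by
  have hn0 : 0 < (n : ℝ) := by exact_mod_cast Nat.pos_of_ne_zero hn
  have hB2 : 0 < B F x ^ 2 := by positivity
  rw [mOpt, ← Real.mul_rpow (by positivity) (by positivity),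
    ← Real.rpow_mul (by positivity), ← Real.rpow_natCast, ← Real.rpow_mul (by positivity)]
  norm_num only
  rw [Real.rpow_neg_one]
  field_simp

lemma rpow_neg_half_eq_relLevel (hV : 0 < V F x) (hB : B F x ≠ 0) {n : ℕ} (hn : n ≠ 0) {m : ℝ}
    (hm : 0 < m) :
    m ^ (-(1 / 2) : ℝ) = relLevel F x n m * mOpt F x n ^ (-(1 / 2) : ℝ) := by
  have h := mOpt_pos hV hB hn
  rw [relLevel, ← Real.mul_rpow (div_pos hm h).le h.le, div_mul_cancel₀ _ h.ne']

lemma inv_mul_rpow_neg_half (hV : 0 < V F x) (hB : B F x ≠ 0) {n : ℕ} (hn : n ≠ 0) {m : ℝ}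
    (hm : 0 < m) :
    (n : ℝ)⁻¹ * m ^ (-(1 / 2) : ℝ)
      = (n : ℝ) ^ (-(4 / 3) : ℝ) * (gainConst F x / V F x * relLevel F x n m) := by
  rw [rpow_neg_half_eq_relLevel hV hB hn hm, mul_left_comm, inv_mul_mOpt_rpow hV hB hn]
  ring

lemma rpow_neg_two_eq_relLevel (hV : 0 < V F x) (hB : B F x ≠ 0) {n : ℕ} (hn : n ≠ 0) {m : ℝ}
    (hm : 0 < m) :
    m ^ (-2 : ℝ)
      = (n : ℝ) ^ (-(4 / 3) : ℝ) * (gainConst F x / (4 * B F x ^ 2) * relLevel F x n m ^ 4) := by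
  have e : m ^ (-2 : ℝ) = (m ^ (-(1 / 2) : ℝ)) ^ 4 := by
    rw [← Real.rpow_natCast, ← Real.rpow_mul hm.le]
    norm_num
  have h1 := inv_mul_mOpt_rpow hV hB hn
  have h3 := mOpt_rpow_pow_three hV hB hn
  rw [e, rpow_neg_half_eq_relLevel hV hB hn hm]
  set w := mOpt F x n ^ (-(1 / 2) : ℝ)
  calc (relLevel F x n m * w) ^ 4 = relLevel F x n m ^ 4 * (w ^ 3 * w) := by ring
    _ = relLevel F x n m ^ 4 * (V F x / (4 * B F x ^ 2) * ((n : ℝ)⁻¹ * w)) := by rw [h3]; ring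
    _ = _ := by
      rw [h1]
      field_simp

/-- At relative level `t` the variance gain is `n^{-4/3} c t` and the squared bias `n^{-4/3} c
t⁴/4`, where `c` is `gainConst`. -/
lemma leadingMse_eq (hV : 0 < V F x) (hB : B F x ≠ 0) {n : ℕ} (hn : n ≠ 0) {m : ℝ}
    (hm : 0 < m) :
    leadingMse F x n m = (n : ℝ)⁻¹ * sigmaSq F x
      - (n : ℝ) ^ (-(4 / 3) : ℝ) * (3 / 4) * gainConst F x
      + (n : ℝ) ^ (-(4 / 3) : ℝ) * gainConst F x * excess (relLevel F x n m) := by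
  rw [leadingMse, inv_mul_rpow_neg_half hV hB hn hm, rpow_neg_two_eq_relLevel hV hB hn hm, excess]
  field_simp
  ring

theorem leadingMse_mOpt_lt (hV : 0 < V F x) (hB : B F x ≠ 0) {n : ℕ} (hn : n ≠ 0) {m : ℝ}
    (hm : 0 < m) (hne : m ≠ mOpt F x n) :
    leadingMse F x n (mOpt F x n) < leadingMse F x n m := by
  have hn0 : 0 < (n : ℝ) := by exact_mod_cast Nat.pos_of_ne_zero hn
  rw [leadingMse_eq hV hB hn hm, leadingMse_eq hV hB hn (mOpt_pos hV hB hn),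
    relLevel_mOpt hV hB hn]
  have ht1 : relLevel F x n m ≠ 1 := by
    intro h
    have h2 := relLevel_rpow hV hB hn hm
    rw [h, Real.one_rpow, eq_comm, div_eq_one_iff_eq (mOpt_pos hV hB hn).ne'] at h2
    exact hne h2
  have h0 : 0 < (relLevel F x n m - 1) ^ 2 := by
    have := sub_ne_zero.2 ht1
    positivity
  have h1 := sq_le_excess (relLevel F x n m)
  have h2 : excess 1 = 0 := by norm_num [excess]
  rw [h2]
  have h3 : 0 < excess (relLevel F x n m) := by linarith
  have h4 := gainConst_pos hV hB
  gcongr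

lemma tendsto_mOpt (hV : 0 < V F x) (hB : B F x ≠ 0) : Tendsto (mOpt F x) atTop atTop := by
  have hB2 : 0 < B F x ^ 2 := by positivity
  have h : Tendsto (fun n : ℕ => (n : ℝ) ^ (2 / 3 : ℝ)) atTop atTop :=
    (tendsto_rpow_atTop (by norm_num)).comp tendsto_natCast_atTop_atTop
  exact h.atTop_mul_const (by positivity)

/-- A risk function whose expansion has the leading part `leadingMse F x`. -/
def HasLeadingMse (R : ℕ → ℝ → ℝ) (F : (Fin d → ℝ) → ℝ) (x : Fin d → ℝ) : Prop :=
  ∀ ε > 0, ∀ᶠ p : ℕ × ℝ in atTop ×ˢ atTop, |R p.1 p.2 - leadingMse F x p.1 p.2|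
    ≤ ε * ((p.1 : ℝ)⁻¹ * p.2 ^ (-(1 / 2) : ℝ)) + ε * p.2 ^ (-2 : ℝ)

variable {R : ℕ → ℝ → ℝ}

/-- The expansion of the risk along a smoothing sequence, in terms of the relative level. -/
lemma HasLeadingMse.eventually_seq (hR : HasLeadingMse R F x) (hV : 0 < V F x)
    (hB : B F x ≠ 0) {m : ℕ → ℝ} (hm : Tendsto m atTop atTop) {ε : ℝ} (hε : 0 < ε) :
    ∀ᶠ n : ℕ in atTop, |R n (m n) - ((n : ℝ)⁻¹ * sigmaSq F x
        - (n : ℝ) ^ (-(4 / 3) : ℝ) * (3 / 4) * gainConst F x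
        + (n : ℝ) ^ (-(4 / 3) : ℝ) * gainConst F x * excess (relLevel F x n (m n)))|
      ≤ ε * (n : ℝ) ^ (-(4 / 3) : ℝ) * (1 + excess (relLevel F x n (m n))) := by
  have hB2 : 0 < B F x ^ 2 := by positivity
  have hc := gainConst_pos hV hB
  set K := gainConst F x / V F x + gainConst F x / (4 * B F x ^ 2) with hK
  have hK0 : 0 < K := by positivity
  have hK1 : gainConst F x / V F x ≤ K := le_add_of_nonneg_right (by positivity)
  have hK2 : gainConst F x / (4 * B F x ^ 2) ≤ K := le_add_of_nonneg_left (by positivity)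
  -- `K` bounds the coefficients of `t` and `t⁴`; the `9` is that of `add_pow_four_le_excess`.
  have h1 := (tendsto_id.prodMk hm).eventually (hR (ε / (9 * K)) (by positivity))
  filter_upwards [h1, eventually_ne_atTop 0, hm.eventually_gt_atTop 0] with n h hn hmn
  simp only [id] at h
  rw [leadingMse_eq hV hB hn hmn] at h
  refine h.trans ?_
  rw [inv_mul_rpow_neg_half hV hB hn hmn, rpow_neg_two_eq_relLevel hV hB hn hmn]
  have ht := (relLevel_pos hV hB hn hmn).le
  set t := relLevel F x n (m n)
  set ν := (n : ℝ) ^ (-(4 / 3) : ℝ)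
  have hν : 0 ≤ ν := Real.rpow_nonneg (Nat.cast_nonneg n) _
  calc _ = ε / (9 * K) * ν * (gainConst F x / V F x * t
        + gainConst F x / (4 * B F x ^ 2) * t ^ 4) := by ring
    _ ≤ ε / (9 * K) * ν * (K * t + K * t ^ 4) := by gcongr
    _ = ε / (9 * K) * ν * K * (t + t ^ 4) := by ring
    _ ≤ ε / (9 * K) * ν * K * (9 * (1 + excess t)) := by
      gcongr
      exact add_pow_four_le_excess t
    _ = _ := by field_simp

lemma tendsto_excess_of_isEquivalent (hV : 0 < V F x) (hB : B F x ≠ 0) {m : ℕ → ℝ}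
    (hm : m ~[atTop] mOpt F x) :
    Tendsto (fun n => excess (relLevel F x n (m n))) atTop (𝓝 0) := by
  have hz : ∀ᶠ n in atTop, mOpt F x n ≠ 0 := by
    filter_upwards [eventually_ne_atTop 0] with n hn using (mOpt_pos hV hB hn).ne'
  have h := (isEquivalent_iff_tendsto_one hz).1 hm
  have h1 : Tendsto (fun n => relLevel F x n (m n)) atTop (𝓝 1) := by
    have := h.rpow_const (p := -(1 / 2)) (Or.inl one_ne_zero)
    rwa [Real.one_rpow] at this
  have h2 : Continuous excess := by unfold excess; fun_prop
  have h3 := (h2.tendsto 1).comp h1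
  have h4 : excess 1 = 0 := by norm_num [excess]
  rwa [h4] at h3

/-- `sq_le_excess` gives `t → 1`, and raising to the power `-2` recovers `m / mOpt`. -/
lemma isEquivalent_of_tendsto_excess (hV : 0 < V F x) (hB : B F x ≠ 0) {m : ℕ → ℝ}
    (hm : Tendsto m atTop atTop)
    (h : Tendsto (fun n => excess (relLevel F x n (m n))) atTop (𝓝 0)) :
    m ~[atTop] mOpt F x := by
  have hz : ∀ᶠ n in atTop, mOpt F x n ≠ 0 := by
    filter_upwards [eventually_ne_atTop 0] with n hn using (mOpt_pos hV hB hn).ne'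
  rw [isEquivalent_iff_tendsto_one hz]
  have hev : ∀ᶠ n in atTop, n ≠ 0 ∧ 0 < m n :=
    (eventually_ne_atTop 0).and (hm.eventually_gt_atTop 0)
  have h1 : Tendsto (fun n => (relLevel F x n (m n) - 1) ^ 2) atTop (𝓝 0) := by
    have h2 := h.const_mul 2
    rw [mul_zero] at h2
    refine squeeze_zero' (Eventually.of_forall fun n => sq_nonneg _) ?_ h2
    exact Eventually.of_forall fun n => sq_le_excess _
  have h2 : Tendsto (fun n => relLevel F x n (m n)) atTop (𝓝 1) := by
    have h3 := (Real.continuous_sqrt.tendsto 0).comp h1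
    rw [Real.sqrt_zero] at h3
    simp only [Function.comp_def, Real.sqrt_sq_eq_abs] at h3
    have h4 := ((tendsto_zero_iff_abs_tendsto_zero _).2 h3).add_const 1
    simpa using h4
  have h3 := h2.rpow_const (p := -2) (Or.inl one_ne_zero)
  rw [Real.one_rpow] at h3
  refine h3.congr' ?_
  filter_upwards [hev] with n hn using relLevel_rpow hV hB hn.1 hn.2

theorem HasLeadingMse.isLittleO (hR : HasLeadingMse R F x) (hV : 0 < V F x) (hB : B F x ≠ 0)
    {m : ℕ → ℝ} (hm : m ~[atTop] mOpt F x) :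
    (fun n : ℕ => R n (m n) - ((n : ℝ)⁻¹ * sigmaSq F x
        - (n : ℝ) ^ (-(4 / 3) : ℝ) * (3 / 4) * gainConst F x))
      =o[atTop] fun n : ℕ => (n : ℝ) ^ (-(4 / 3) : ℝ) := by
  have hmt : Tendsto m atTop atTop := hm.symm.tendsto_atTop (tendsto_mOpt hV hB)
  have hc := gainConst_pos hV hB
  rw [isLittleO_iff]
  intro ε hε
  -- The second entry gives `c * excess ≤ ε/2`; the first gives `1 + excess ≤ 2`, so the error,
  -- taken with `ε/4`, is also at most `ε/2` (both relative to `n^{-4/3}`).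
  have hη : 0 < min 1 (ε / (2 * (gainConst F x + 1))) := by positivity
  have hlt := (tendsto_excess_of_isEquivalent hV hB hm).eventually_lt_const hη
  filter_upwards [hR.eventually_seq hV hB hmt (ε := ε / 4) (by positivity), hlt,
    eventually_ne_atTop 0, hmt.eventually_gt_atTop 0] with n h hn1 hn hmn
  have he := excess_nonneg (relLevel F x n (m n))
  have h1 := hn1.le.trans (min_le_left _ _)
  have h2 := hn1.le.trans (min_le_right _ _)
  set t := excess (relLevel F x n (m n))
  set ν := (n : ℝ) ^ (-(4 / 3) : ℝ)
  set c := gainConst F x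
  have hν : 0 ≤ ν := Real.rpow_nonneg (Nat.cast_nonneg n) _
  rw [Real.norm_eq_abs, Real.norm_of_nonneg hν]
  have h3 : c * t ≤ ε / 2 := by
    calc c * t ≤ (c + 1) * (ε / (2 * (c + 1))) := by gcongr; linarith
      _ = ε / 2 := by field_simp
  have h4 : ν * (c * t) ≤ ν * (ε / 2) := by gcongr
  have h5 : ε / 4 * ν * (1 + t) ≤ ε / 4 * ν * (1 + 1) := by gcongr
  have h6 : 0 ≤ ν * (c * t) := by positivity
  rw [abs_le] at h ⊢
  constructor <;> linarith [h.1, h.2]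

theorem HasLeadingMse.isAsymptoticallyOptimal_iff (hR : HasLeadingMse R F x) (hV : 0 < V F x)
    (hB : B F x ≠ 0) (m : ℕ → ℝ) :
    IsAsymptoticallyOptimal R (fun n : ℕ => (n : ℝ) ^ (-(4 / 3) : ℝ)) m
      ↔ m ~[atTop] mOpt F x := by
  have hc := gainConst_pos hV hB
  constructor
  · rintro ⟨hm, hopt⟩
    refine isEquivalent_of_tendsto_excess hV hB hm ?_
    rw [tendsto_order]
    have hpos : ∀ᶠ n in atTop, n ≠ 0 ∧ 0 < m n :=
      (eventually_ne_atTop 0).and (hm.eventually_gt_atTop 0)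
    refine ⟨fun a ha => ?_, fun a ha => ?_⟩
    · exact Eventually.of_forall fun n => ha.trans_le (excess_nonneg _)
    · set c := gainConst F x with hcdef
      -- Comparison with `mOpt` gives `c t ≤ 3ε + ε t`: one `ε` from optimality, one from the error
      -- at `mOpt`, and `ε(1 + t)` from the error at `m`. Absorbing `ε t ≤ c t/2` leaves `c t ≤ 6ε <
      -- c a`.
      set ε := min (c / 2) (c * a / 8) with hεdef
      have hε : 0 < ε := by positivity
      have hε1 : ε ≤ c / 2 := min_le_left _ _
      have hε2 : ε ≤ c * a / 8 := min_le_right _ _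
      filter_upwards [hpos, hopt _ (tendsto_mOpt hV hB) ε hε, hR.eventually_seq hV hB hm hε,
        hR.eventually_seq hV hB (tendsto_mOpt hV hB) hε] with n hn h1 h2 h3
      have hn0 : 0 < (n : ℝ) := by exact_mod_cast Nat.pos_of_ne_zero hn.1
      rw [relLevel_mOpt hV hB hn.1, show excess 1 = 0 by norm_num [excess]] at h3
      have he := excess_nonneg (relLevel F x n (m n))
      rw [← hcdef] at h2 h3
      set t := excess (relLevel F x n (m n))
      set ν := (n : ℝ) ^ (-(4 / 3) : ℝ)
      have hν : 0 < ν := Real.rpow_pos_of_pos hn0 _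
      rw [abs_le] at h2 h3
      have h4 : ν * (c * t) ≤ ν * (3 * ε + ε * t) := by linarith [h2.1, h3.2]
      have h5 := le_of_mul_le_mul_left h4 hν
      have h6 : ε * t ≤ c / 2 * t := by gcongr
      have h7 : c * t < c * a := by
        have : 0 < c * a := by positivity
        linarith
      exact lt_of_mul_lt_mul_left h7 hc.le
  · intro hm
    have hmt : Tendsto m atTop atTop := hm.symm.tendsto_atTop (tendsto_mOpt hV hB)
    refine ⟨hmt, fun m' hm' ε hε => ?_⟩
    set c := gainConst F x with hcdef
    -- An error coefficient of at most `c` lets the competitor's own excess pay for the part of its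
    -- error that grows with the excess.
    have hε' : 0 < min c (ε / 2) := by positivity
    have hlo := isLittleO_iff.1 (hR.isLittleO hV hB hm) (half_pos hε)
    filter_upwards [hlo, hR.eventually_seq hV hB hm' hε', eventually_ne_atTop 0,
      hm'.eventually_gt_atTop 0] with n h1 h2 hn hmn
    have he := excess_nonneg (relLevel F x n (m' n))
    rw [← hcdef] at h1 h2
    set t := excess (relLevel F x n (m' n))
    set ν := (n : ℝ) ^ (-(4 / 3) : ℝ)
    have hν : 0 ≤ ν := Real.rpow_nonneg (Nat.cast_nonneg n) _
    rw [Real.norm_eq_abs, Real.norm_of_nonneg hν] at h1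
    rw [abs_le] at h1 h2
    have h3 : min c (ε / 2) * ν * (1 + t) ≤ ε / 2 * ν + ν * c * t := by
      have a1 : min c (ε / 2) * ν ≤ ε / 2 * ν := by gcongr; exact min_le_right _ _
      have a2 : min c (ε / 2) * (ν * t) ≤ c * (ν * t) := by gcongr; exact min_le_left _ _
      linarith
    linarith [h1.2, h2.1]

end Optimal

end Szasz

theorem mainTheorem2 {d : ℕ} {Ω : Type*} [MeasurableSpace Ω] (P : Measure Ω)
    [IsProbabilityMeasure P] (μ : Measure (Fin d → ℝ)) [IsProbabilityMeasure μ]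
    (hsupp : ∀ᵐ y ∂μ, 0 ≤ y)
    (X : ℕ → Ω → Fin d → ℝ) (hlaw : ∀ i, HasLaw (X i) μ P) (hindep : iIndepFun X P)
    (hF : Szasz.InteriorC2 (Szasz.distFun μ)) :
    (∀ S : Set (Fin d → ℝ), IsCompact S → S ⊆ Szasz.posOrthant d →
      ∀ ε > 0, ∀ᶠ p : ℕ × ℝ in atTop ×ˢ atTop, ∀ x ∈ S,
        |Szasz.mse P X (Szasz.distFun μ) x p.1 p.2
            - ((p.1 : ℝ)⁻¹ * Szasz.sigmaSq (Szasz.distFun μ) x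
              - (p.1 : ℝ)⁻¹ * p.2 ^ (-(1 / 2) : ℝ) * Szasz.V (Szasz.distFun μ) x
              + p.2 ^ (-2 : ℝ) * Szasz.B (Szasz.distFun μ) x ^ 2)|
          ≤ ε * ((p.1 : ℝ)⁻¹ * p.2 ^ (-(1 / 2) : ℝ)) + ε * p.2 ^ (-2 : ℝ)) ∧
    (∀ x ∈ Szasz.posOrthant d,
      Szasz.V (Szasz.distFun μ) x * Szasz.B (Szasz.distFun μ) x ≠ 0 →
      (∀ n : ℕ, 1 ≤ n → 0 < Szasz.mOpt (Szasz.distFun μ) x n ∧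
        ∀ m : ℝ, 0 < m → m ≠ Szasz.mOpt (Szasz.distFun μ) x n →
          Szasz.leadingMse (Szasz.distFun μ) x n (Szasz.mOpt (Szasz.distFun μ) x n)
            < Szasz.leadingMse (Szasz.distFun μ) x n m) ∧
      (∀ m : ℕ → ℝ,
        Szasz.IsAsymptoticallyOptimal (Szasz.mse P X (Szasz.distFun μ) x)
            (fun n : ℕ => (n : ℝ) ^ (-(4 / 3) : ℝ)) m
          ↔ m ~[atTop] Szasz.mOpt (Szasz.distFun μ) x) ∧
      (∀ m : ℕ → ℝ, m ~[atTop] Szasz.mOpt (Szasz.distFun μ) x →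
        (fun n : ℕ => Szasz.mse P X (Szasz.distFun μ) x n (m n)
            - ((n : ℝ)⁻¹ * Szasz.sigmaSq (Szasz.distFun μ) x
              - (n : ℝ) ^ (-(4 / 3) : ℝ) * (3 / 4)
                * (Szasz.V (Szasz.distFun μ) x ^ 4
                    / (4 * Szasz.B (Szasz.distFun μ) x ^ 2)) ^ (1 / 3 : ℝ)))
          =o[atTop] fun n : ℕ => (n : ℝ) ^ (-(4 / 3) : ℝ))) := by
  have hmse : ∀ S : Set (Fin d → ℝ), IsCompact S → S ⊆ Szasz.posOrthant d →
      ∀ ε > 0, ∀ᶠ p : ℕ × ℝ in atTop ×ˢ atTop, ∀ x ∈ S,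
        |Szasz.mse P X (Szasz.distFun μ) x p.1 p.2 - Szasz.leadingMse (Szasz.distFun μ) x p.1 p.2|
          ≤ ε * ((p.1 : ℝ)⁻¹ * p.2 ^ (-(1 / 2) : ℝ)) + ε * p.2 ^ (-2 : ℝ) :=
    fun S hS hSp ε hε => Szasz.eventually_mse hlaw hindep hF hS hSp hε
  refine ⟨hmse, fun x hx hVB => ?_⟩
  have hB : Szasz.B (Szasz.distFun μ) x ≠ 0 := right_ne_zero_of_mul hVB
  have hV : 0 < Szasz.V (Szasz.distFun μ) x :=
    (Szasz.V_distFun_nonneg μ x).lt_of_ne' (left_ne_zero_of_mul hVB)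
  -- Part (b) needs the uniform expansion only on the compact set `{x}`.
  have hR : Szasz.HasLeadingMse (Szasz.mse P X (Szasz.distFun μ) x) (Szasz.distFun μ) x := by
    intro ε hε
    filter_upwards [hmse {x} isCompact_singleton (Set.singleton_subset_iff.2 hx) ε hε] with p hp
    exact hp x rfl
  refine ⟨fun n hn => ⟨Szasz.mOpt_pos hV hB (by omega), fun m hm hne =>
    Szasz.leadingMse_mOpt_lt hV hB (by omega) hm hne⟩, fun m =>
    hR.isAsymptoticallyOptimal_iff hV hB m, fun m hm => hR.isLittleO hV hB hm⟩
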